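/- Let $n\ge 0$, let $W=W(B_n)=\{\pm1\}^n\rtimes S_n$ be the Weyl group of type $B_n$, acting on its reflection representation $E=\mathbb R^n$ by signed permutations of the coordinates, and let $R(W)$ be the Grothendieck group of finite-dimensional complex representations of $W$ (the group of virtual characters). The elliptic pairing on $R(W)$ is $$\langle\sigma,\sigma'\rangle^{\mathrm{ell}}_W=\frac1{|W|}\sum_{w\in W}\sigma(w)\,\sigma'(w)\,{\det}_E(1-w),$$ and $\overline R(W)$ denotes the quotient of $R(W)$ by the radical of this pairing. The elliptic fake degree of a class $[\pi]\in\overline R(W)$ is the rational function $$F_{[\pi]}=\frac{(q-1)^n}{|W|}\sum_{w\in W}\pi(w)\,\frac{{\det}_E(1-w)}{{\det}_E(1-qw)}$$ in the indeterminate $q$; it depends only on the class $[\pi]$. Let $\lambda=(\lambda_1\ge\lambda_2\ge\cdots)$ be a partition of $n$, viewed as a left-justified Young diagram with boxes $(i,j)$, $1\le j\le\lambda_i$. Put $n(\lambda)=\sum_{i\ge1}(i-1)\lambda_i$, let $c(i,j)=j-i$ be the content of the box $(i,j)$ and $h(i,j)$ its hook length. Let $\sigma_\lambda$ be the irreducible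 complex representation of $S_n$ attached to $\lambda$ (the left ideal of $\mathbb C[S_n]$ generated by a Young symmetrizer of shape $\lambda$, so that $\sigma_{(n)}$ is the trivial and $\sigma_{(1,\dots,1)}$ the sign representation), and let $\lambda\times\emptyset$ be the irreducible representation of $W(B_n)$ obtained by pulling $\sigma_\lambda$ back along the projection $W(B_n)\to S_n$. **Proposition.** The elliptic fake degree of $[\lambda\times\emptyset]\in\overline R(W(B_n))$ is $$F_{[\lambda\times\emptyset]}=(q-1)^n\,q^{2n(\lambda)}\prod_{(i,j)\in\lambda}\frac{1-q^{2c(i,j)+1}}{1-q^{2h(i,j)}}.$$ -/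

import Mathlib

open Polynomial

noncomputable section

/-! ### Virtual characters, the elliptic pairing and elliptic fake degrees -/

/-- The Grothendieck group `R(W)` of finite-dimensional complex representations of a finite
group `W`, realized as the group of virtual characters: the additive group of functions on `W`
generated by the characters of the finite-dimensional complex representations. -/
def virtualCharacters (W : Type) [Group W] : AddSubgroup (W → ℂ) :=
  AddSubgroup.closure {χ | ∃ (V : Type) (_ : AddCommGroup V) (_ : Module ℂ V)
    (_ : FiniteDimensional ℂ V) (ρ : Representation ℂ W V), ρ.character = χ}

/-- The class in `R(W)` of a finite-dimensional complex representation. -/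
def virtualCharacters.of {W : Type} [Group W] {V : Type} [AddCommGroup V] [Module ℂ V]
    [FiniteDimensional ℂ V] (ρ : Representation ℂ W V) : virtualCharacters W :=
  ⟨ρ.character, AddSubgroup.subset_closure ⟨V, _, _, inferInstance, ρ, rfl⟩⟩

/-- Virtual characters are class functions. -/
theorem virtualCharacters_conj {W : Type} [Group W] (π : virtualCharacters W) (g h : W) :
    π.1 (h * g * h⁻¹) = π.1 g := by
  obtain ⟨f, hf⟩ := π
  induction hf using AddSubgroup.closure_induction with
  | mem x hx =>
    obtain ⟨V, _, _, _, ρ, rfl⟩ := hx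
    exact Representation.char_conj ρ g h
  | zero => rfl
  | add x y _ _ hx hy =>
    show x _ + y _ = x _ + y _
    rw [show x _ = x _ from hx, show y _ = y _ from hy]
  | neg x _ hx =>
    show - x _ = - x _
    rw [show x _ = x _ from hx]

section Elliptic

variable {W : Type} [Group W] [Fintype W] {E : Type} [AddCommGroup E] [Module ℝ E]
  (r : Representation ℝ W E)

/-- The polynomial `det_E(1 - q w)` in the indeterminate `q`. -/
def detOneSubQ (w : W) : ℝ[X] :=
  LinearMap.det (1 - (X : ℝ[X]) • (r w).baseChange ℝ[X])

/-- The elliptic pairing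
`⟨σ, σ'⟩ = (1 / |W|) * ∑ w, σ(w) σ'(w) det_E(1 - w)` of two class functions. -/
def ellipticPairing (σ σ' : W → ℂ) : ℂ :=
  (Fintype.card W : ℂ)⁻¹ * ∑ w, σ w * σ' w * ((LinearMap.det (1 - r w) : ℝ) : ℂ)

/-- The radical of the elliptic pairing on `R(W)`. -/
def ellipticRadical : AddSubgroup (virtualCharacters W) where
  carrier := {σ | ∀ σ' : virtualCharacters W, ellipticPairing r σ.1 σ'.1 = 0}
  zero_mem' := fun σ' => by simp [ellipticPairing]
  add_mem' := fun {a b} ha hb σ' => by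
    have h1 := ha σ'
    have h2 := hb σ'
    simp only [ellipticPairing] at h1 h2 ⊢
    rw [show (0 : ℂ) = 0 + 0 by simp]
    nth_rewrite 1 [← h1]
    rw [← h2, ← mul_add, ← Finset.sum_add_distrib]
    congr 1
    refine Finset.sum_congr rfl fun w _ => ?_
    simp only [AddSubgroup.coe_add, Pi.add_apply]
    ring
  neg_mem' := fun {a} ha σ' => by
    have h1 := ha σ'
    simp only [ellipticPairing] at h1 ⊢
    simpa using h1

/-- The group `R̄(W) = R(W) / rad` of virtual elliptic representations. -/
abbrev EllipticGroup : Type := virtualCharacters W ⧸ ellipticRadical r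

/-- The class `[π]` in `R̄(W)` of a virtual character `π`. -/
def ellipticClass : virtualCharacters W →+ EllipticGroup r :=
  QuotientAddGroup.mk' (ellipticRadical r)

/-- The elliptic fake degree on the level of `R(W)`:
`(q - 1)^l * (1 / |W|) * ∑ w, π(w) det_E(1 - w) / det_E(1 - q w)`, where `l = dim E`, as a
rational function of the indeterminate `q`. -/
def fakeDegreeAux : virtualCharacters W →+ RatFunc ℂ where
  toFun π := (RatFunc.X - 1) ^ Module.finrank ℝ E / (Fintype.card W : RatFunc ℂ) *
    ∑ w, RatFunc.C (π.1 w * ((LinearMap.det (1 - r w) : ℝ) : ℂ)) /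
      algebraMap ℂ[X] (RatFunc ℂ) ((detOneSubQ r w).map Complex.ofRealHom)
  map_zero' := by simp
  map_add' a b := by
    rw [← mul_add, ← Finset.sum_add_distrib]
    congr 1
    refine Finset.sum_congr rfl fun w _ => ?_
    simp only [AddSubgroup.coe_add, Pi.add_apply, add_mul, map_add, add_div]

/-- A class function which is orthogonal to all characters vanishes. -/
theorem classFunction_eq_zero (f : W → ℂ) (hf : ∀ g h : W, f (h * g * h⁻¹) = f g)
    (h0 : ∀ (V : Type) [AddCommGroup V] [Module ℂ V] [FiniteDimensional ℂ V]
      (ρ : Representation ℂ W V), ∑ w, f w * ρ.character w = 0) : f = 0 := by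
  classical
  have : NeZero (Nat.card W : ℂ) := ⟨by exact_mod_cast Nat.card_pos.ne'⟩
  have : FiniteDimensional ℂ (MonoidAlgebra ℂ W) :=
    Module.Finite.of_basis (MonoidAlgebra.basis W ℂ)
  let z : (MonoidAlgebra ℂ W) := ∑ w, f w • MonoidAlgebra.of ℂ W w
  have hz1 : ∀ g : W, MonoidAlgebra.of ℂ W g * z = z * MonoidAlgebra.of ℂ W g := by
    intro g
    simp only [z, Finset.mul_sum, Finset.sum_mul, mul_smul_comm, smul_mul_assoc, ← map_mul]
    refine Fintype.sum_equiv (MulAut.conj g).toEquiv _ _ fun w => ?_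
    simp [hf]
  have hz : ∀ a : (MonoidAlgebra ℂ W), a * z = z * a := by
    intro a
    induction a using MonoidAlgebra.induction_on with
    | of g => exact hz1 g
    | add a b ha hb => rw [add_mul, mul_add, ha, hb]
    | smul c a ha => rw [smul_mul_assoc, mul_smul_comm, ha]
  have key : z = 0 := by
    by_contra hne
    obtain ⟨e, he, hspan⟩ := IsSemisimpleRing.ideal_eq_span_idempotent (Ideal.span {z})
    have hze : e ∈ Ideal.span {z} := by rw [hspan]; exact Ideal.mem_span_singleton_self e
    obtain ⟨a, ha⟩ := Ideal.mem_span_singleton'.1 hze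
    let I : Submodule ℂ (MonoidAlgebra ℂ W) := (Ideal.span {z}).restrictScalars ℂ
    have hzI : z ∈ I := Ideal.mem_span_singleton_self z
    have : Nontrivial I := ⟨⟨⟨z, hzI⟩, 0, fun h => hne (congrArg Subtype.val h)⟩⟩
    let L : Module.End ℂ (MonoidAlgebra ℂ W) := LinearMap.mulLeft ℂ z
    have hLI : ∀ x ∈ I, L x ∈ I := fun x hx => (Ideal.span {z}).mul_mem_left z hx
    obtain ⟨m, hm⟩ := Module.End.exists_eigenvalue (L.restrict hLI)
    obtain ⟨v, hv⟩ := hm.exists_hasEigenvector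
    have hv1 : z * v.1 = m • v.1 := congrArg Subtype.val hv.apply_eq_smul
    have hv0 : v.1 ≠ 0 := fun h => hv.2 (Subtype.ext h)
    have hm0 : m ≠ 0 := by
      rintro rfl
      rw [zero_smul] at hv1
      have hve : v.1 ∈ Ideal.span {e} := by rw [← hspan]; exact v.2
      obtain ⟨x, hx⟩ := Ideal.mem_span_singleton'.1 hve
      apply hv0
      calc v.1 = v.1 * e := by rw [← hx, mul_assoc, he.eq]
        _ = z * v.1 * a := by rw [← ha, ← mul_assoc, hz, mul_assoc]
        _ = 0 := by rw [hv1, zero_mul]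
    let U : Submodule ℂ (MonoidAlgebra ℂ W) := Module.End.eigenspace L m
    have hU : ∀ g : W, ∀ x ∈ U, LinearMap.mulLeft ℂ (MonoidAlgebra.of ℂ W g) x ∈ U := by
      intro g x hx
      rw [Module.End.mem_eigenspace_iff] at hx ⊢
      simp only [L, LinearMap.mulLeft_apply] at hx ⊢
      rw [← mul_assoc, ← hz1, mul_assoc, hx, mul_smul_comm]
    let ρ : Representation ℂ W U :=
      { toFun := fun g => (LinearMap.mulLeft ℂ (MonoidAlgebra.of ℂ W g)).restrict (hU g)
        map_one' := by ext x; simp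
        map_mul' := fun g h => by
          refine LinearMap.ext fun x => Subtype.ext ?_
          show (MonoidAlgebra.of ℂ W (g * h)) * x.1 =
            MonoidAlgebra.of ℂ W g * (MonoidAlgebra.of ℂ W h * x.1)
          rw [map_mul, mul_assoc] }
    have hsum : ∑ w, f w • ρ w = m • (1 : Module.End ℂ U) := by
      refine LinearMap.ext fun x => Subtype.ext ?_
      have hx := Module.End.mem_eigenspace_iff.1 x.2
      simp only [L, LinearMap.mulLeft_apply, z, Finset.sum_mul, smul_mul_assoc] at hx
      rw [show ((m • (1 : Module.End ℂ U)) x).1 = m • x.1 from rfl, ← hx]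
      simp only [LinearMap.sum_apply, LinearMap.smul_apply, Submodule.coe_sum, Submodule.coe_smul]
      rfl
    have ht := h0 U ρ
    have ht2 := congrArg (LinearMap.trace ℂ U) hsum
    simp only [map_sum, map_smul, smul_eq_mul] at ht2
    simp only [Representation.character] at ht
    rw [ht, Module.End.one_eq_id, LinearMap.trace_id] at ht2
    have hvU : v.1 ∈ U := Module.End.mem_eigenspace_iff.2 hv1
    have : Nontrivial U := ⟨⟨⟨v.1, hvU⟩, 0, fun h => hv0 (congrArg Subtype.val h)⟩⟩
    have hpos : (Module.finrank ℂ U : ℂ) ≠ 0 := by exact_mod_cast Module.finrank_pos.ne'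
    exact mul_ne_zero hm0 hpos ht2.symm
  funext w
  have := congrArg (fun a : (MonoidAlgebra ℂ W) => a.coeff w) key
  simpa [z, MonoidAlgebra.of_apply, Finsupp.single_apply, Finsupp.finsetSum_apply] using this

/-- The elliptic fake degree depends only on the class in `R̄(W)`. -/
theorem fakeDegreeAux_eq_zero (π : virtualCharacters W) (hπ : π ∈ ellipticRadical r) :
    fakeDegreeAux r π = 0 := by
  have hdet : ∀ g h : W, LinearMap.det (1 - r (h * g * h⁻¹)) = LinearMap.det (1 - r g) := by
    intro g h
    have : (1 : Module.End ℝ E) - r (h * g * h⁻¹) = r h * (1 - r g) * r h⁻¹ := by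
      rw [mul_sub, sub_mul, mul_one, ← map_mul, ← map_mul, ← map_mul, mul_inv_cancel, map_one]
    rw [this, map_mul, map_mul, mul_comm, ← mul_assoc, ← map_mul LinearMap.det, ← map_mul r,
      inv_mul_cancel, map_one, map_one, one_mul]
  have hf := classFunction_eq_zero
    (fun w => π.1 w * ((LinearMap.det (1 - r w) : ℝ) : ℂ))
    (fun g h => by simp only [virtualCharacters_conj, hdet])
    (fun V _ _ _ ρ => by
      have h := hπ (virtualCharacters.of ρ)
      rw [ellipticPairing, mul_eq_zero, inv_eq_zero] at h
      rcases h with h | h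
      · exact absurd h (by exact_mod_cast Fintype.card_ne_zero)
      · rw [← h]
        refine Finset.sum_congr rfl fun w _ => ?_
        simp only [virtualCharacters.of]
        ring)
  simp only [fakeDegreeAux, AddMonoidHom.coe_mk, ZeroHom.coe_mk]
  rw [Finset.sum_eq_zero, mul_zero]
  intro w _
  rw [show π.1 w * ((LinearMap.det (1 - r w) : ℝ) : ℂ) = 0 from congrFun hf w]
  simp

/-- The elliptic fake degree `F_[π]` of a class `[π]` in `R̄(W)`. -/
def ellipticFakeDegree : EllipticGroup r →+ RatFunc ℂ :=
  QuotientAddGroup.lift (ellipticRadical r) (fakeDegreeAux r) (fakeDegreeAux_eq_zero r)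

end Elliptic

/-! ### The Weyl group of type `B_n` and its reflection representation -/

/-- The Weyl group `W(B_n)`: the group `{±1}^n ⋊ S_n` of signed permutations. -/
abbrev WeylB (n : ℕ) : Type := (Fin n → ℤˣ) ⋊[mulAutArrow] Equiv.Perm (Fin n)

instance WeylB.instFintype (n : ℕ) : Fintype (WeylB n) :=
  Fintype.ofEquiv _ SemidirectProduct.equivProd.symm

/-- The reflection representation `E = ℝ^n` of `W(B_n)`: the element `(ε, σ)` sends the standard
basis vector `e_j` to `ε_{σ j} e_{σ j}`. -/
def reflB (n : ℕ) : Representation ℝ (WeylB n) (Fin n → ℝ) where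
  toFun w :=
    { toFun := fun v i => ((w.left i : ℤ) : ℝ) * v (w.right⁻¹ i)
      map_add' := fun v v' => by funext i; simp [mul_add]
      map_smul' := fun c v => by funext i; simp [mul_left_comm] }
  map_one' := by
    refine LinearMap.ext fun v => funext fun i => ?_
    simp
  map_mul' w w' := by
    refine LinearMap.ext fun v => funext fun i => ?_
    have h : (w * w').left i = w.left i * w'.left (w.right⁻¹ i) := rfl
    simp [mul_assoc, h, -SemidirectProduct.mul_left]

/-! ### The irreducible representations of the symmetric group -/

namespace YoungDiagram

variable (μ : YoungDiagram)

/-- A numbering of the boxes of the Young diagram `μ` by `0, …, n - 1`. It exists if and only if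
`μ` is the diagram of a partition of `n`. -/
abbrev Numbering (n : ℕ) : Type := Fin n ≃ {c : ℕ × ℕ // c ∈ μ.cells}

/-- The statistic `n(μ) = ∑_{i ≥ 1} (i - 1) μ_i` (rows are counted from `0` in the code). -/
def nStat : ℕ := ∑ i ∈ Finset.range (μ.colLen 0), i * μ.rowLen i

/-- The content `j - i` of the box in row `i` and column `j`. -/
def content (c : ℕ × ℕ) : ℤ := (c.2 : ℤ) - (c.1 : ℤ)

/-- The hook length of the box `c` in row `i` and column `j` of `μ`: the number of boxes of `μ`
to the right of `c` in the same row, plus the number of boxes of `μ` below `c` in the same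
column, plus one. -/
def hookLength (c : ℕ × ℕ) : ℕ :=
  (μ.rowLen c.1 - (c.2 + 1)) + (μ.colLen c.2 - (c.1 + 1)) + 1

variable {μ} {n : ℕ} (T : μ.Numbering n)

open Classical in
/-- The Young symmetrizer `(∑ p) * (∑ sign(q) q)`, where `p` runs over the permutations that
preserve the rows of `T` and `q` over those that preserve its columns. -/
def youngSymmetrizer : MonoidAlgebra ℂ (Equiv.Perm (Fin n)) :=
  (∑ p : Equiv.Perm (Fin n) with ∀ x, (T (p x)).1.1 = (T x).1.1,
      MonoidAlgebra.of ℂ (Equiv.Perm (Fin n)) p) *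
  (∑ q : Equiv.Perm (Fin n) with ∀ x, (T (q x)).1.2 = (T x).1.2,
      ((Equiv.Perm.sign q : ℤ) : ℂ) • MonoidAlgebra.of ℂ (Equiv.Perm (Fin n)) q)

/-- The space of the irreducible representation `σ_μ` of `S_n`: the left ideal of the group
algebra generated by the Young symmetrizer. -/
def spechtSpace : Submodule ℂ (MonoidAlgebra ℂ (Equiv.Perm (Fin n))) :=
  LinearMap.range (LinearMap.mulRight ℂ (youngSymmetrizer T))

/-- The irreducible representation `σ_μ` of `S_n`, acting by left multiplication on the left
ideal generated by the Young symmetrizer. Up to isomorphism it does not depend on the numbering;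
`σ_(n)` is trivial and `σ_(1, …, 1)` is the sign representation. -/
def specht : Representation ℂ (Equiv.Perm (Fin n)) (spechtSpace T) where
  toFun g := (LinearMap.mulLeft ℂ (MonoidAlgebra.of ℂ (Equiv.Perm (Fin n)) g)).restrict (by
    rintro _ ⟨x, rfl⟩
    exact ⟨MonoidAlgebra.of ℂ (Equiv.Perm (Fin n)) g * x, by simp [mul_assoc]⟩)
  map_one' := by
    refine LinearMap.ext fun x => Subtype.ext ?_
    show MonoidAlgebra.of ℂ (Equiv.Perm (Fin n)) 1 * x.1 = x.1
    rw [map_one, one_mul]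
  map_mul' g h := by
    refine LinearMap.ext fun x => Subtype.ext ?_
    show MonoidAlgebra.of ℂ (Equiv.Perm (Fin n)) (g * h) * x.1 =
      MonoidAlgebra.of ℂ (Equiv.Perm (Fin n)) g * (MonoidAlgebra.of ℂ (Equiv.Perm (Fin n)) h * x.1)
    rw [map_mul, mul_assoc]

instance finiteDimensional_spechtSpace : FiniteDimensional ℂ (spechtSpace T) :=
  have : FiniteDimensional ℂ (MonoidAlgebra ℂ (Equiv.Perm (Fin n))) :=
    Module.Finite.of_basis (MonoidAlgebra.basis (Equiv.Perm (Fin n)) ℂ)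
  inferInstance

/-- The irreducible representation `μ × ∅` of `W(B_n)`: the pullback of `σ_μ` along the
projection of `W(B_n)` onto `S_n`. -/
def bipartitionEmpty : Representation ℂ (WeylB n) (spechtSpace T) :=
  (specht T).comp SemidirectProduct.rightHom

end YoungDiagram

end

/-! Write an element of `W(B_n)` as a sign vector `ε` and a permutation `g`. Both determinants
factor over the cycles of `g`: a cycle of length `k` whose signs multiply to `s` contributes `(1 -
s) / (1 - s q^k)`. The representation does not see `ε`, and averaging over signs makes `s = ±1`
equally likely on each cycle independently, so each cycle contributes `1 / (1 + q^k)`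
(`sum_signs_det_div`). What remains is `(1/n!) ∑ χ_μ(g) ∏ 1/(1 + q^k)`. Since `1/(1 + q^k) = (1 -
q^k)/(1 - q^(2k))`, this is the Schur function of `μ` under `p_k ↦ (1 - a^k)/(1 - Q^k)` with `a =
q`, `Q = q^2`. The hook-content formula evaluates it (`specialization`): for `a = Q^N` it is the
principal specialization in `N` variables, and both sides are polynomials in `a`.

The identification with a Schur function is the Frobenius formula (`alternant_mul_charPoly`). A
trace computation replaces the Specht character by the coefficients of the Young symmetrizer `e`,
which satisfies `e^2 = c e` with `c ≠ 0`. The polynomial `∑ e(g) p_g` is a trace on the `n`-th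
tensor power of the `N`-dimensional space of the generic diagonal matrix times `e`. There the
Casimir of `gl_N` acts through the sum of transpositions, hence by a scalar on `e`. Its radial part
shows that the Vandermonde determinant times this trace is an eigenvector of `∑ (x_i ∂_i)^2`
(`exists_casimir`), so all its exponents have the same sum of squares.

Column antisymmetry shows that each sorted exponent is dominated by `μ + ρ`, where `ρ` is the
staircase. Together with equal norms this leaves only the permutations of `μ + ρ`, and an
alternating polynomial with such exponents is a multiple of the alternant. The leading coefficient
is computed to be `c` (`coeff_shiftedExp_eq`). -/

noncomputable section

/-! ### Column-injective fillings and dominance -/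

namespace YoungDiagram

variable {μ : YoungDiagram} {n : ℕ}

theorem card_row_eq (T : μ.Numbering n) (k : ℕ) :
    (Finset.univ.filter fun u => (T u).1.1 = k).card = μ.rowLen k := by
  rw [rowLen_eq_card]
  refine Finset.card_bij (fun u _ => (T u).1) ?_ ?_ ?_
  · intro u hu
    rw [mem_row_iff]
    exact ⟨(T u).2, by simpa using hu⟩
  · intro u _ v _ h
    exact T.injective (Subtype.ext h)
  · intro c hc
    rw [mem_row_iff] at hc
    exact ⟨T.symm ⟨c, hc.1⟩, by simp [hc.2], by simp⟩

theorem card_col_eq (T : μ.Numbering n) (k : ℕ) :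
    (Finset.univ.filter fun u => (T u).1.2 = k).card = μ.colLen k := by
  rw [colLen_eq_card]
  refine Finset.card_bij (fun u _ => (T u).1) ?_ ?_ ?_
  · intro u hu
    rw [mem_col_iff]
    exact ⟨(T u).2, by simpa using hu⟩
  · intro u _ v _ h
    exact T.injective (Subtype.ext h)
  · intro c hc
    rw [mem_col_iff] at hc
    exact ⟨T.symm ⟨c, hc.1⟩, by simp [hc.2], by simp⟩

theorem card_col_row_lt (T : μ.Numbering n) (k m : ℕ) :
    (Finset.univ.filter fun u => (T u).1.2 = k ∧ (T u).1.1 < m).card = min m (μ.colLen k) := by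
  rw [← Finset.card_range (min m (μ.colLen k))]
  refine Finset.card_bij (fun u _ => (T u).1.1) ?_ ?_ ?_
  · intro u hu
    obtain ⟨h1, h2⟩ := (Finset.mem_filter.1 hu).2
    rw [Finset.mem_range, lt_min_iff, ← mem_iff_lt_colLen, ← h1]
    exact ⟨h2, (T u).2⟩
  · intro u hu v hv h
    have hu' := (Finset.mem_filter.1 hu).2
    have hv' := (Finset.mem_filter.1 hv).2
    exact T.injective (Subtype.ext (Prod.ext h (hu'.1.trans hv'.1.symm)))
  · intro r hr
    rw [Finset.mem_range, lt_min_iff, ← mem_iff_lt_colLen] at hr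
    exact ⟨T.symm ⟨(r, k), hr.2⟩, by simp [hr.1], by simp⟩

/-- `f` takes distinct values on the boxes of each column. -/
def ColInjective (T : μ.Numbering n) {α : Type} (f : Fin n → α) : Prop :=
  ∀ u v, (T u).1.2 = (T v).1.2 → f u = f v → u = v

/-- A column holds at most `|S|` boxes with colours in `S`, and at most as many as its length; the
smaller of these numbers counts its boxes in the first `|S|` rows. -/
theorem ColInjective.card_col_mem_le {T : μ.Numbering n} {α : Type} [DecidableEq α]
    {f : Fin n → α} (hf : ColInjective T f) (k : ℕ) (S : Finset α) :
    (Finset.univ.filter fun u => (T u).1.2 = k ∧ f u ∈ S).card ≤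
      (Finset.univ.filter fun u => (T u).1.2 = k ∧ (T u).1.1 < S.card).card := by
  rw [card_col_row_lt, le_min_iff]
  constructor
  · refine Finset.card_le_card_of_injOn f (fun u hu => ?_) fun u hu v hv h => ?_
    · exact (Finset.mem_filter.1 hu).2.2
    · have hu' := (Finset.mem_filter.1 hu).2
      have hv' := (Finset.mem_filter.1 hv).2
      exact hf u v (hu'.1.trans hv'.1.symm) h
  · rw [← card_col_eq T]
    exact Finset.card_le_card fun u => by simpa using fun h _ => h

theorem card_eq_sum_card_col (T : μ.Numbering n) (p : Fin n → Prop) [DecidablePred p] :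
    (Finset.univ.filter p).card =
      ∑ k ∈ Finset.univ.image (fun u => (T u).1.2),
        (Finset.univ.filter fun u => (T u).1.2 = k ∧ p u).card := by
  rw [Finset.card_eq_sum_card_image (fun u => (T u).1.2) (Finset.univ.filter p)]
  have h : ∀ k, ((Finset.univ.filter p).filter fun u => (T u).1.2 = k) =
      Finset.univ.filter fun u => (T u).1.2 = k ∧ p u := fun k => by
    ext u; simp [and_comm]
  simp only [h]
  refine Finset.sum_subset (Finset.image_subset_image (Finset.filter_subset _ _)) ?_
  intro k _ hk
  rw [Finset.card_eq_zero, Finset.filter_eq_empty_iff]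
  rintro u _ ⟨h1, h2⟩
  exact hk (Finset.mem_image.2 ⟨u, by simpa using h2, h1⟩)

theorem card_row_lt (T : μ.Numbering n) (m : ℕ) :
    (Finset.univ.filter fun u => (T u).1.1 < m).card = ∑ k ∈ Finset.range m, μ.rowLen k := by
  rw [Finset.card_eq_sum_card_fiberwise (f := fun u => (T u).1.1) (t := Finset.range m)
    (fun u hu => by simpa using hu)]
  refine Finset.sum_congr rfl fun k hk => ?_
  rw [← card_row_eq T k]
  congr 1
  ext u
  have := Finset.mem_range.1 hk
  simp only [Finset.mem_filter, Finset.mem_univ, true_and]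
  constructor
  · exact fun h => h.2
  · exact fun h => ⟨by omega, h⟩

/-- Dominance: a filling which is injective on columns has at most `μ_1 + ⋯ + μ_m` entries in a
set of `m` colours. -/
theorem ColInjective.card_mem_le {T : μ.Numbering n} {α : Type} [DecidableEq α]
    {f : Fin n → α} (hf : ColInjective T f) (S : Finset α) :
    (Finset.univ.filter fun u => f u ∈ S).card ≤ ∑ k ∈ Finset.range S.card, μ.rowLen k := by
  rw [← card_row_lt T, card_eq_sum_card_col T, card_eq_sum_card_col T]
  exact Finset.sum_le_sum fun k _ => hf.card_col_mem_le k S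

/-- A filling with the content of the superstandard one which is injective on columns is a column
permutation of the superstandard one. -/
theorem ColInjective.exists_perm {T : μ.Numbering n} {f : Fin n → ℕ} (hf : ColInjective T f)
    (hc : ∀ k, (Finset.univ.filter fun u => f u = k).card = μ.rowLen k) :
    ∃ q : Equiv.Perm (Fin n), (∀ u, (T (q u)).1.2 = (T u).1.2) ∧
      ∀ u, (T (q u)).1.1 = f u := by
  -- For the colours below `m`, the length of the column of `u`, the dominance inequality is an
  -- equality, hence an equality in every column. In the column of `u` it says that all `m` boxes
  -- have colours below `m`.
  have key : ∀ u, f u < μ.colLen (T u).1.2 := by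
    intro u
    set m := μ.colLen (T u).1.2 with hm
    have heq : (Finset.univ.filter fun u => f u ∈ Finset.range m).card =
        (Finset.univ.filter fun u => (T u).1.1 < m).card := by
      rw [card_row_lt, Finset.card_eq_sum_card_fiberwise (f := f) (t := Finset.range m)
        (fun u hu => by simpa using hu)]
      refine Finset.sum_congr rfl fun k hk => ?_
      rw [← hc k]
      congr 1
      ext u
      have := Finset.mem_range.1 hk
      simp only [Finset.mem_filter, Finset.mem_univ, true_and, Finset.mem_range]
      constructor
      · exact fun h => h.2
      · exact fun h => ⟨by omega, h⟩
    rw [card_eq_sum_card_col T, card_eq_sum_card_col T (fun u => (T u).1.1 < m)] at heq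
    have hle := fun k (_ : k ∈ Finset.univ.image (fun u => (T u).1.2)) =>
      hf.card_col_mem_le k (Finset.range m)
    simp only [Finset.card_range] at hle
    have h1 := (Finset.sum_eq_sum_iff_of_le hle).1 heq (T u).1.2
      (Finset.mem_image_of_mem _ (Finset.mem_univ u))
    rw [card_col_row_lt, ← hm, min_self] at h1
    have h4 := h1.ge.trans' (hm.symm ▸ (card_col_eq T (T u).1.2)).le
    have h2 := Finset.eq_of_subset_of_card_le (s := Finset.univ.filter fun v =>
      (T v).1.2 = (T u).1.2 ∧ f v ∈ Finset.range m)
      (t := Finset.univ.filter fun v => (T v).1.2 = (T u).1.2)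
      (fun v => by simpa using fun h _ => h) h4
    have h3 : u ∈ Finset.univ.filter fun v => (T v).1.2 = (T u).1.2 := by simp
    rw [← h2] at h3
    simpa using h3
  -- The colour serves as the new row index inside the same column.
  let q0 : Fin n → Fin n := fun u => T.symm ⟨(f u, (T u).1.2), mem_iff_lt_colLen.2 (key u)⟩
  have hq0 : ∀ u, (T (q0 u)).1 = (f u, (T u).1.2) := fun u => by simp [q0]
  have hinj : Function.Injective q0 := fun u v h => by
    have h' := congrArg (fun w => (T w).1) h
    simp only [hq0, Prod.mk.injEq] at h'
    exact hf u v h'.2 h'.1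
  refine ⟨Equiv.ofBijective q0 (Finite.injective_iff_bijective.1 hinj), fun u => ?_, fun u => ?_⟩
  · show (T (q0 u)).1.2 = _
    rw [hq0]
  · show (T (q0 u)).1.1 = _
    rw [hq0]

/-! ### Row and column stabilizers and the Young symmetrizer -/

/-- `g` preserves the rows of `T`. -/
def RowStab (T : μ.Numbering n) (g : Equiv.Perm (Fin n)) : Prop :=
  ∀ x, (T (g x)).1.1 = (T x).1.1

/-- `g` preserves the columns of `T`. -/
def ColStab (T : μ.Numbering n) (g : Equiv.Perm (Fin n)) : Prop :=
  ∀ x, (T (g x)).1.2 = (T x).1.2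

variable {T : μ.Numbering n}

theorem RowStab.mul {g h : Equiv.Perm (Fin n)} (hg : RowStab T g) (hh : RowStab T h) :
    RowStab T (g * h) := fun x => (hg _).trans (hh x)

theorem ColStab.mul {g h : Equiv.Perm (Fin n)} (hg : ColStab T g) (hh : ColStab T h) :
    ColStab T (g * h) := fun x => (hg _).trans (hh x)

theorem RowStab.inv {g : Equiv.Perm (Fin n)} (hg : RowStab T g) : RowStab T g⁻¹ :=
  fun x => by simpa using (hg (g⁻¹ x)).symm

theorem ColStab.inv {g : Equiv.Perm (Fin n)} (hg : ColStab T g) : ColStab T g⁻¹ :=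
  fun x => by simpa using (hg (g⁻¹ x)).symm

theorem RowStab.swap {u v : Fin n} (h : (T u).1.1 = (T v).1.1) : RowStab T (Equiv.swap u v) := by
  intro x
  by_cases hu : x = u
  · rw [hu, Equiv.swap_apply_left, h]
  · by_cases hv : x = v
    · rw [hv, Equiv.swap_apply_right, h]
    · rw [Equiv.swap_apply_of_ne_of_ne hu hv]

theorem ColStab.swap {u v : Fin n} (h : (T u).1.2 = (T v).1.2) : ColStab T (Equiv.swap u v) := by
  intro x
  by_cases hu : x = u
  · rw [hu, Equiv.swap_apply_left, h]
  · by_cases hv : x = v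
    · rw [hv, Equiv.swap_apply_right, h]
    · rw [Equiv.swap_apply_of_ne_of_ne hu hv]

theorem eq_one_of_rowStab_of_colStab {g : Equiv.Perm (Fin n)} (h1 : RowStab T g)
    (h2 : ColStab T g) : g = 1 :=
  Equiv.ext fun x => T.injective (Subtype.ext (Prod.ext (h1 x) (h2 x)))

local notation "ℂS" => MonoidAlgebra ℂ (Equiv.Perm (Fin n))
local notation "δ" => MonoidAlgebra.of ℂ (Equiv.Perm (Fin n))

open Classical in
/-- The sum of the row stabilizer. -/
def rowSum (T : μ.Numbering n) : ℂS :=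
  ∑ p : Equiv.Perm (Fin n) with RowStab T p, MonoidAlgebra.of ℂ (Equiv.Perm (Fin n)) p

open Classical in
/-- The signed sum of the column stabilizer. -/
def colSum (T : μ.Numbering n) : ℂS :=
  ∑ q : Equiv.Perm (Fin n) with ColStab T q,
      ((Equiv.Perm.sign q : ℤ) : ℂ) • MonoidAlgebra.of ℂ (Equiv.Perm (Fin n)) q

theorem youngSymmetrizer_eq : youngSymmetrizer T = rowSum T * colSum T := by
  unfold youngSymmetrizer rowSum colSum RowStab ColStab
  congr!

theorem rowSum_mul_of {g : Equiv.Perm (Fin n)} (hg : RowStab T g) :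
    rowSum T * δ g = rowSum T := by
  classical
  rw [rowSum, Finset.sum_mul]
  refine Finset.sum_bij' (fun p _ => p * g) (fun p _ => p * g⁻¹) ?_ ?_ ?_ ?_ ?_
  · intro p hp; simpa using (Finset.mem_filter.1 hp).2.mul hg
  · intro p hp; simpa using (Finset.mem_filter.1 hp).2.mul hg.inv
  · simp
  · simp
  · intro p _; rw [map_mul]

theorem of_mul_colSum {g : Equiv.Perm (Fin n)} (hg : ColStab T g) :
    δ g * colSum T = ((Equiv.Perm.sign g : ℤ) : ℂ) • colSum T := by
  classical
  rw [colSum, Finset.mul_sum, Finset.smul_sum]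
  refine Finset.sum_bij' (fun p _ => g * p) (fun p _ => g⁻¹ * p) ?_ ?_ ?_ ?_ ?_
  · intro p hp; simpa using hg.mul (Finset.mem_filter.1 hp).2
  · intro p hp; simpa using hg.inv.mul (Finset.mem_filter.1 hp).2
  · simp
  · simp
  · intro p _
    rw [map_mul, smul_smul, mul_smul_comm, map_mul, Units.val_mul, Int.cast_mul, ← mul_assoc,
      ← Int.cast_mul, ← Units.val_mul, Int.units_mul_self]
    simp

theorem ColInjective.or_exists_swap {α : Type} (f : Fin n → α) :
    ColInjective T f ∨ ∃ u v, u ≠ v ∧ (T u).1.2 = (T v).1.2 ∧ f u = f v := by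
  by_contra! h
  obtain ⟨h1, h2⟩ := h
  exact h1 fun u v huv hf => by
    by_contra hne
    exact h2 u v hne huv hf

/-- The sandwich lemma: `a h b` is a multiple of the Young symmetrizer. -/
theorem exists_rowSum_mul_of_mul_colSum (T : μ.Numbering n) (h : Equiv.Perm (Fin n)) :
    ∃ c : ℂ, rowSum T * δ h * colSum T = c • youngSymmetrizer T := by
  -- Colour `u` by the row of `h u`. If columns get distinct colours, `h` is a row permutation times
  -- a column permutation. Otherwise some column transposition is conjugated by `h` to a row
  -- transposition, and the product equals its own negative.
  rcases ColInjective.or_exists_swap (T := T) (fun u => (T (h u)).1.1) with hf | hf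
  · obtain ⟨q, hq1, hq2⟩ := hf.exists_perm (fun k => by
      rw [← card_row_eq T k]
      refine Finset.card_bij (fun u _ => h u) (by simp) (by simp) fun v hv => ⟨h⁻¹ v, ?_, ?_⟩
      · simpa using hv
      · simp)
    have hr : RowStab T (h * q⁻¹) := fun x => by
      have := hq2 (q⁻¹ x)
      simp at this
      simp [this]
    refine ⟨((Equiv.Perm.sign q : ℤ) : ℂ), ?_⟩
    have : h = (h * q⁻¹) * q := by group
    rw [this, map_mul, ← mul_assoc, rowSum_mul_of hr, mul_assoc, of_mul_colSum hq1,
      mul_smul_comm, youngSymmetrizer_eq]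
  · obtain ⟨u, v, hne, hcol, hrow⟩ := hf
    refine ⟨0, ?_⟩
    have h1 : rowSum T * δ h * colSum T = - (rowSum T * δ h * colSum T) := by
      conv_lhs => rw [← rowSum_mul_of (RowStab.swap hrow), mul_assoc (rowSum T), ← map_mul]
      have : Equiv.swap (h u) (h v) * h = h * Equiv.swap u v := by
        rw [Equiv.swap_apply_apply]; group
      rw [this, map_mul, ← mul_assoc, mul_assoc, of_mul_colSum (ColStab.swap hcol),
        Equiv.Perm.sign_swap hne]
      simp
    rw [zero_smul]
    have h2 : (2 : ℂ) • (rowSum T * δ h * colSum T) = 0 := by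
      rw [two_smul]; nth_rewrite 1 [h1]; exact neg_add_cancel _
    exact (smul_eq_zero.1 h2).resolve_left two_ne_zero

theorem exists_rowSum_mul_mul_colSum (T : μ.Numbering n) (x : ℂS) :
    ∃ c : ℂ, rowSum T * x * colSum T = c • youngSymmetrizer T := by
  induction x using MonoidAlgebra.induction_on with
  | of g => exact exists_rowSum_mul_of_mul_colSum T g
  | add x y hx hy =>
    obtain ⟨c, hc⟩ := hx
    obtain ⟨d, hd⟩ := hy
    exact ⟨c + d, by rw [mul_add, add_mul, hc, hd, add_smul]⟩
  | smul r x hx =>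
    obtain ⟨c, hc⟩ := hx
    exact ⟨r * c, by rw [mul_smul_comm, smul_mul_assoc, hc, smul_smul]⟩

theorem exists_youngSymmetrizer_sq (T : μ.Numbering n) :
    ∃ c : ℂ, youngSymmetrizer T * youngSymmetrizer T = c • youngSymmetrizer T := by
  obtain ⟨c, hc⟩ := exists_rowSum_mul_mul_colSum T (colSum T * rowSum T)
  exact ⟨c, by rw [← hc, youngSymmetrizer_eq]; simp only [mul_assoc]⟩

/-- The scalar by which the Young symmetrizer fails to be idempotent. -/
def symmetrizerScalar (T : μ.Numbering n) : ℂ := (exists_youngSymmetrizer_sq T).choose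

theorem youngSymmetrizer_sq (T : μ.Numbering n) :
    youngSymmetrizer T * youngSymmetrizer T = symmetrizerScalar T • youngSymmetrizer T :=
  (exists_youngSymmetrizer_sq T).choose_spec

theorem youngSymmetrizer_expand (T : μ.Numbering n) :
    youngSymmetrizer T = ∑ x : Equiv.Perm (Fin n) × Equiv.Perm (Fin n),
      open Classical in if RowStab T x.1 ∧ ColStab T x.2 then
        ((Equiv.Perm.sign x.2 : ℤ) : ℂ) • δ (x.1 * x.2) else 0 := by
  classical
  rw [youngSymmetrizer_eq, rowSum, colSum, Finset.sum_mul_sum, Finset.sum_filter,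
    Fintype.sum_prod_type]
  refine Finset.sum_congr rfl fun p _ => ?_
  rw [Finset.sum_filter]
  by_cases hp : RowStab T p
  · simp only [hp, if_true, true_and]
    refine Finset.sum_congr rfl fun q _ => ?_
    rw [mul_smul_comm, map_mul]
  · simp [hp]

theorem coeff_youngSymmetrizer (T : μ.Numbering n) (g : Equiv.Perm (Fin n)) :
    (youngSymmetrizer T).coeff g = ∑ x : Equiv.Perm (Fin n) × Equiv.Perm (Fin n),
      open Classical in if RowStab T x.1 ∧ ColStab T x.2 ∧ x.1 * x.2 = g then
        ((Equiv.Perm.sign x.2 : ℤ) : ℂ) else 0 := by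
  classical
  rw [youngSymmetrizer_expand, MonoidAlgebra.coeff_sum, Finsupp.finsetSum_apply]
  refine Finset.sum_congr rfl fun x _ => ?_
  by_cases h : RowStab T x.1 ∧ ColStab T x.2
  · rw [if_pos h]
    by_cases h2 : x.1 * x.2 = g <;> simp [h, h2, MonoidAlgebra.of_apply]
  · rw [if_neg h, if_neg (fun h' => h ⟨h'.1, h'.2.1⟩)]
    rfl

/-- The row and column stabilizers meet only in the identity, so `p q = 1` forces `p = q = 1`. -/
theorem coeff_one_youngSymmetrizer (T : μ.Numbering n) :
    (youngSymmetrizer T).coeff 1 = 1 := by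
  classical
  rw [coeff_youngSymmetrizer, Finset.sum_eq_single (1, 1)]
  · rw [if_pos ⟨fun _ => rfl, fun _ => rfl, by simp⟩]; simp
  · rintro ⟨p, q⟩ _ hne
    refine if_neg fun ⟨h1, h2, h3⟩ => hne ?_
    have hp : p = q⁻¹ := eq_inv_of_mul_eq_one_left h3
    have hp1 : p = 1 := eq_one_of_rowStab_of_colStab h1 (hp ▸ h2.inv)
    rw [hp1] at hp
    rw [hp1, Prod.mk.injEq]
    exact ⟨rfl, inv_eq_one.1 hp.symm⟩
  · simp

/-! ### Traces on the group algebra and the Specht character -/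

theorem trace_monoidAlgebra {G : Type} [Group G] [Fintype G]
    (f : Module.End ℂ (MonoidAlgebra ℂ G)) :
    LinearMap.trace ℂ _ f = ∑ h, (f (MonoidAlgebra.of ℂ G h)).coeff h := by
  classical
  rw [LinearMap.trace_eq_matrix_trace ℂ (MonoidAlgebra.basis G ℂ), Matrix.trace]
  refine Finset.sum_congr rfl fun h _ => ?_
  rw [Matrix.diag_apply, LinearMap.toMatrix_apply]
  simp [MonoidAlgebra.basis]

/-- If the scalar vanished, right multiplication by the symmetrizer would be nilpotent and so have
trace zero; but its trace is `n!` times the coefficient of the identity, which is `1`. -/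
theorem symmetrizerScalar_ne_zero (T : μ.Numbering n) : symmetrizerScalar T ≠ 0 := by
  intro h0
  have hsq := youngSymmetrizer_sq T
  rw [h0, zero_smul] at hsq
  have hnil : IsNilpotent (LinearMap.mulRight ℂ (youngSymmetrizer T)) :=
    ⟨2, by rw [pow_two]; ext x; simp [mul_assoc, hsq]⟩
  have htr := LinearMap.isNilpotent_trace_of_isNilpotent hnil
  have := htr.eq_zero
  rw [trace_monoidAlgebra] at this
  simp [MonoidAlgebra.of_apply, MonoidAlgebra.coeff_single_mul_apply,
    coeff_one_youngSymmetrizer] at this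

/-- The character of a Specht module in terms of the Young symmetrizer. -/
theorem character_specht (T : μ.Numbering n) (g : Equiv.Perm (Fin n)) :
    symmetrizerScalar T * (specht T).character g =
      ∑ h, (youngSymmetrizer T).coeff (h⁻¹ * g⁻¹ * h) := by
  have : FiniteDimensional ℂ (MonoidAlgebra ℂ (Equiv.Perm (Fin n))) :=
    Module.Finite.of_basis (MonoidAlgebra.basis (Equiv.Perm (Fin n)) ℂ)
  -- With `e` the symmetrizer, `B A` is the scalar times the action of `g` on the Specht space,
  -- while `A B` is `x ↦ g x e` on the whole group algebra, whose trace can be read off on the basis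
  -- of group elements.
  let A : spechtSpace T →ₗ[ℂ] ℂS := (LinearMap.mulLeft ℂ (δ g)) ∘ₗ (spechtSpace T).subtype
  let B : ℂS →ₗ[ℂ] spechtSpace T := (LinearMap.mulRight ℂ (youngSymmetrizer T)).rangeRestrict
  have hBA : B ∘ₗ A = symmetrizerScalar T • specht T g := by
    refine LinearMap.ext fun v => Subtype.ext ?_
    obtain ⟨_, x, rfl⟩ := v
    show δ g * (x * youngSymmetrizer T) * youngSymmetrizer T =
      symmetrizerScalar T • (δ g * (x * youngSymmetrizer T))
    rw [mul_assoc, mul_assoc, youngSymmetrizer_sq, mul_smul_comm, mul_smul_comm]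
  have h := LinearMap.trace_comp_comm' A B
  rw [hBA, map_smul, smul_eq_mul] at h
  rw [Representation.character]
  refine h.symm.symm.trans ?_
  rw [trace_monoidAlgebra]
  refine Finset.sum_congr rfl fun h _ => ?_
  show (δ g * (δ h * youngSymmetrizer T)).coeff h = _
  rw [← mul_assoc, ← map_mul, MonoidAlgebra.of_apply, MonoidAlgebra.coeff_single_mul_apply]
  simp [mul_assoc]

/-- Pairing the Specht character with a class function. -/
theorem sum_character_specht (T : μ.Numbering n) {K : Type} [Field K] [Algebra ℂ K]
    (φ : Equiv.Perm (Fin n) → K) (hφ : ∀ g h, φ (h * g * h⁻¹) = φ g) (hinv : ∀ g, φ g⁻¹ = φ g) :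
    algebraMap ℂ K (symmetrizerScalar T) * ∑ g, algebraMap ℂ K ((specht T).character g) * φ g =
      (Fintype.card (Equiv.Perm (Fin n)) : K) *
        ∑ g, algebraMap ℂ K ((youngSymmetrizer T).coeff g) * φ g := by
  simp only [Finset.mul_sum, ← mul_assoc, ← map_mul, character_specht]
  simp only [map_sum, Finset.sum_mul]
  rw [Finset.sum_comm]
  simp only [mul_assoc]
  rw [← Finset.mul_sum, Fintype.card, ← nsmul_eq_mul, ← Finset.sum_const]
  refine Finset.sum_congr rfl fun h _ => ?_
  refine Fintype.sum_equiv ((Equiv.inv _).trans (MulAut.conj h⁻¹).toEquiv) _ _ fun g => ?_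
  have : φ (h⁻¹ * (g⁻¹ * h)) = φ g := by
    rw [← hinv g, ← hφ g⁻¹ h⁻¹, inv_inv, mul_assoc]
  simp [this, mul_assoc]

end YoungDiagram

/-! ### Cycles, determinants of signed permutation matrices, sums over signs -/

section Cycles

variable {α : Type}

/-- The cycles of a permutation, fixed points included. -/
abbrev CycleClass (g : Equiv.Perm α) : Type := Quotient (Equiv.Perm.SameCycle.setoid g)

instance (g : Equiv.Perm α) : DecidableEq (CycleClass g) := Classical.decEq _

/-- The class of an element in the set of cycles. -/
def cycleClass (g : Equiv.Perm α) (i : α) : CycleClass g := Quotient.mk _ i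

theorem cycleClass_eq {g : Equiv.Perm α} {i j : α} :
    cycleClass g i = cycleClass g j ↔ g.SameCycle i j := Quotient.eq

theorem cycleClass_apply (g : Equiv.Perm α) (i : α) : cycleClass g (g i) = cycleClass g i :=
  cycleClass_eq.2 (Equiv.Perm.sameCycle_apply_left.2 (Equiv.Perm.SameCycle.refl g i))

theorem cycleClass_surjective (g : Equiv.Perm α) : Function.Surjective (cycleClass g) :=
  Quotient.exists_rep

theorem invariant_iff_exists {ι : Type} (g : Equiv.Perm α) (f : α → ι) :
    f ∘ g = f ↔ ∃ φ : CycleClass g → ι, f = φ ∘ cycleClass g := by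
  constructor
  · intro h
    refine ⟨Quotient.lift f ?_, rfl⟩
    rintro i j ⟨k, rfl⟩
    have hz : ∀ k : ℤ, ∀ i, f ((g ^ k) i) = f i := by
      intro k
      induction k using Int.induction_on with
      | zero => simp
      | succ k ih =>
        intro i
        rw [zpow_add, zpow_one, Equiv.Perm.mul_apply, ih]
        exact congrFun h i
      | pred k ih =>
        intro i
        rw [zpow_sub, zpow_one, Equiv.Perm.mul_apply, ih]
        have := congrFun h (g⁻¹ i)
        simpa using this.symm
    exact (hz k i).symm
  · rintro ⟨φ, rfl⟩
    funext i
    simp [cycleClass_apply]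

variable [Fintype α]

instance (g : Equiv.Perm α) : Fintype (CycleClass g) := by classical exact Fintype.ofFinite _

/-- The length of a cycle. -/
def cycleLen (g : Equiv.Perm α) (c : CycleClass g) : ℕ :=
  (Finset.univ.filter fun i => cycleClass g i = c).card

theorem cycleLen_pos (g : Equiv.Perm α) (c : CycleClass g) : 0 < cycleLen g c := by
  obtain ⟨i, hi⟩ := cycleClass_surjective g c
  exact Finset.card_pos.2 ⟨i, by simp [hi]⟩

variable [DecidableEq α]

/-- The matrix `v ↦ (i ↦ e i * v (g⁻¹ i))`. -/
def weightedPermMatrix {R : Type} [CommRing R] (g : Equiv.Perm α) (e : α → R) : Matrix α α R :=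
  Matrix.of fun i j => if g j = i then e i else 0

/-- A nonzero Leibniz term needs `τ i ∈ {i, g i}` for all `i`. If `τ` moves `i` to `g i`,
injectivity makes it move `g i` as well, so around the single cycle `τ` is either `1` or `g`. A
fixed point reduces `α` to one element, where these two coincide, so that case is separate. -/
theorem det_one_sub_weighted_cycle {R : Type} [CommRing R] [Nonempty α] (g : Equiv.Perm α)
    (e : α → R) (hg : ∀ i j, g.SameCycle i j) :
    (1 - weightedPermMatrix g e).det = 1 - ∏ i, e i := by
  by_cases hfix : ∃ i, g i = i
  · obtain ⟨i, hi⟩ := hfix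
    have hall : ∀ j, j = i := fun j => by
      obtain ⟨k, hk⟩ := hg i j
      rw [← hk, Equiv.Perm.zpow_apply_eq_self_of_apply_eq_self hi]
    have : Unique α := ⟨⟨i⟩, hall⟩
    rw [Matrix.det_unique, Fintype.prod_unique]
    simp [weightedPermMatrix, hall default, hall (g i)]
  · push Not at hfix
    have hne : g ≠ 1 := fun h => hfix (Classical.arbitrary α) (by rw [h]; rfl)
    have hM : ∀ i j, (1 - weightedPermMatrix g e) i j =
        (if i = j then 1 else 0) - if g j = i then e i else 0 := fun i j => by
      simp [weightedPermMatrix, Matrix.one_apply]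
    rw [Matrix.det_apply, ← Finset.sum_subset (Finset.subset_univ {1, g})]
    · rw [Finset.sum_pair hne.symm]
      have hcyc : g.IsCycle := ⟨Classical.arbitrary α, hfix _, fun j _ => hg _ j⟩
      have hsupp : g.support = Finset.univ := by ext i; simp [hfix]
      rw [hcyc.sign, hsupp]
      have h1 : ∀ i, (1 - weightedPermMatrix g e) ((1 : Equiv.Perm α) i) i = 1 := fun i => by
        rw [hM]; simp [hfix]
      have h2 : ∀ i, (1 - weightedPermMatrix g e) (g i) i = - e (g i) := fun i => by
        rw [hM]; simp [hfix]
      simp only [h1, h2, Finset.prod_const_one, Finset.prod_neg, Equiv.prod_comp g e]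
      rw [Equiv.Perm.sign_one, one_smul, sub_eq_add_neg, Units.smul_def, zsmul_eq_mul]
      push_cast
      rw [neg_mul, ← mul_assoc, ← mul_pow]
      simp
    · intro τ _ hτ
      simp only [Finset.mem_insert, Finset.mem_singleton, not_or] at hτ
      suffices ∃ i, τ i ≠ i ∧ τ i ≠ g i by
        obtain ⟨i, hi1, hi2⟩ := this
        rw [Finset.prod_eq_zero (Finset.mem_univ i), smul_zero]
        rw [hM, if_neg hi1, if_neg hi2.symm, sub_zero]
      by_contra! hcon
      have hex : ∃ i, τ i ≠ i := by
        by_contra! h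
        exact hτ.1 (Equiv.ext h)
      obtain ⟨i, hi⟩ := hex
      have hstep : ∀ j, τ j ≠ j → τ (g j) ≠ g j := fun j hj h => by
        rw [← hcon j hj] at h
        exact hj (τ.injective h)
      refine hτ.2 (Equiv.ext fun j => hcon j ?_)
      obtain ⟨k, -, hk⟩ := (hg i j).exists_pow_eq'
      rw [← hk]
      clear hk
      induction k with
      | zero => exact hi
      | succ k ih => rw [pow_succ', Equiv.Perm.mul_apply]; exact hstep _ ih

theorem det_one_sub_weightedPermMatrix {R : Type} [CommRing R] (g : Equiv.Perm α) (e : α → R) :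
    (1 - weightedPermMatrix g e).det =
      ∏ c : CycleClass g, (1 - ∏ i with cycleClass g i = c, e i) := by
  classical
  -- The matrix is block diagonal along the cycles; the arbitrary order only serves to phrase this
  -- as block triangularity.
  let _ : LinearOrder (CycleClass g) := IsWellOrder.linearOrder WellOrderingRel
  have hM : Matrix.BlockTriangular (1 - weightedPermMatrix g e) (cycleClass g) := by
    intro i j hij
    have h1 : i ≠ j := fun h => (ne_of_gt hij) (by rw [h])
    have h2 : g j ≠ i := fun h => (ne_of_gt hij) (by rw [← h, cycleClass_apply])
    simp [weightedPermMatrix, h1, h2]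
  rw [hM.det_fintype]
  refine Finset.prod_congr rfl fun c _ => ?_
  have hc : ∀ i, cycleClass g (g i) = c ↔ cycleClass g i = c := fun i => by rw [cycleClass_apply]
  have hne : Nonempty {i // cycleClass g i = c} := by
    obtain ⟨i, hi⟩ := Quotient.exists_rep c
    exact ⟨⟨i, hi⟩⟩
  have heq : (1 - weightedPermMatrix g e).toSquareBlock (cycleClass g) c =
      1 - weightedPermMatrix (g.subtypePerm hc) (fun i => e i) := by
    ext i j
    simp [Matrix.toSquareBlock_def, weightedPermMatrix, Matrix.one_apply, Subtype.ext_iff]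
  rw [heq, det_one_sub_weighted_cycle]
  · congr 1
    rw [Finset.prod_subtype (p := fun i => cycleClass g i = c)
      (Finset.univ.filter fun i => cycleClass g i = c) (by simp)]
  · intro i j
    have : g.SameCycle i j := cycleClass_eq.1 (i.2.trans j.2.symm)
    simpa using this

/-- Flipping the sign at one point negates the product, so both values occur equally often. -/
theorem sum_signs_prod {K : Type} [Field K] [CharZero K] {β : Type} [Fintype β] [DecidableEq β]
    [Nonempty β] (F : ℤˣ → K) :
    ∑ ε : β → ℤˣ, F (∏ i, ε i) = 2 ^ Fintype.card β * ((F 1 + F (-1)) / 2) := by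
  obtain ⟨i0⟩ := ‹Nonempty β›
  have h1 : ∑ ε : β → ℤˣ, F (∏ i, ε i) = ∑ ε : β → ℤˣ, F (-∏ i, ε i) := by
    refine Fintype.sum_equiv (Equiv.mulLeft (Pi.mulSingle i0 (-1))) _ _ fun ε => ?_
    simp [Finset.prod_mul_distrib]
  have h2 : ∀ s : ℤˣ, F s + F (-s) = F 1 + F (-1) := fun s => by
    rcases Int.units_eq_one_or s with rfl | rfl
    · rfl
    · rw [neg_neg, add_comm]
  have h3 : ∑ ε : β → ℤˣ, (F (∏ i, ε i) + F (-∏ i, ε i)) =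
      2 ^ Fintype.card β * (F 1 + F (-1)) := by
    simp only [h2, Finset.sum_const, Finset.card_univ, Fintype.card_fun, Fintype.card_units_int]
    simp [mul_add]
  rw [Finset.sum_add_distrib, ← h1, ← two_mul] at h3
  linear_combination h3 / 2

/-- Signs on different fibres are chosen independently, so the sum factors into fibrewise averages.
Surjectivity is needed because over an empty fibre the product is always `1`. -/
theorem sum_signs_prod_classes {K : Type} [Field K] [CharZero K] {γ : Type} [Fintype γ]
    [DecidableEq γ] (f : α → γ) (hf : Function.Surjective f) (F : γ → ℤˣ → K) :
    ∑ ε : α → ℤˣ, ∏ c, F c (∏ i with f i = c, ε i) =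
      2 ^ Fintype.card α * ∏ c, ((F c 1 + F c (-1)) / 2) := by
  classical
  let E : (α → ℤˣ) ≃ (∀ c, {i // f i = c} → ℤˣ) :=
    ((Equiv.sigmaFiberEquiv f).symm.arrowCongr (Equiv.refl ℤˣ)).trans (Equiv.piCurry fun _ _ => ℤˣ)
  have hE : ∀ ε c i, E ε c i = ε i := fun ε c i => rfl
  rw [Fintype.sum_equiv E _ (fun η => ∏ c, F c (∏ i, η c i)) (fun ε => by
    refine Finset.prod_congr rfl fun c _ => ?_
    simp only [hE]
    rw [Finset.prod_subtype (p := fun i => f i = c)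
      (Finset.univ.filter fun i => f i = c) (by simp)])]
  rw [← Fintype.piFinset_univ, ← Finset.prod_univ_sum (fun _ => Finset.univ)
    (fun c (η : {i // f i = c} → ℤˣ) => F c (∏ i, η i))]
  have hcard : Fintype.card α = ∑ c, Fintype.card {i // f i = c} := by
    rw [← Fintype.card_sigma]; exact (Fintype.card_congr (Equiv.sigmaFiberEquiv f)).symm
  rw [hcard, ← Finset.prod_pow_eq_pow_sum, ← Finset.prod_mul_distrib]
  refine Finset.prod_congr rfl fun c _ => ?_
  have : Nonempty {i // f i = c} := ⟨⟨_, (hf c).choose_spec⟩⟩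
  exact sum_signs_prod (F c)

/-- The power sum attached to the cycle type of `g`, as a sum over the colourings fixed by `g`. -/
theorem sum_invariant_prod {R ι : Type} [CommRing R] [Fintype ι] [DecidableEq ι]
    (g : Equiv.Perm α) (x : ι → R) :
    ∑ f : α → ι, (if f ∘ g = f then ∏ u, x (f u) else 0) =
      ∏ c : CycleClass g, ∑ i, x i ^ cycleLen g c := by
  classical
  rw [Finset.prod_univ_sum, Fintype.piFinset_univ, ← Finset.sum_filter]
  symm
  refine Finset.sum_bij (fun φ _ => φ ∘ cycleClass g) ?_ ?_ ?_ ?_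
  · intro φ _
    simpa using (invariant_iff_exists g _).2 ⟨φ, rfl⟩
  · intro φ _ ψ _ h
    exact (cycleClass_surjective g).injective_comp_right h
  · intro f hf
    obtain ⟨φ, rfl⟩ := (invariant_iff_exists g f).1 (by simpa using hf)
    exact ⟨φ, Finset.mem_univ _, rfl⟩
  · intro φ _
    rw [← Finset.prod_fiberwise_of_maps_to (s := Finset.univ) (t := Finset.univ)
      (g := cycleClass g) (fun _ _ => Finset.mem_univ _)]
    refine Finset.prod_congr rfl fun c _ => ?_
    rw [cycleLen, ← Finset.prod_const]
    refine Finset.prod_congr rfl fun i hi => ?_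
    rw [Function.comp_apply, (Finset.mem_filter.1 hi).2]

end Cycles

/-! ### Determinants in the reflection representation -/

section Reflection

variable {n : ℕ}

theorem toMatrix_reflB (w : WeylB n) :
    LinearMap.toMatrix' (reflB n w) =
      weightedPermMatrix w.right (fun i => ((w.left i : ℤ) : ℝ)) := by
  ext i j
  rw [LinearMap.toMatrix'_apply]
  show ((w.left i : ℤ) : ℝ) * (Pi.single j 1 : Fin n → ℝ) (w.right⁻¹ i) = _
  simp only [weightedPermMatrix, Matrix.of_apply, Pi.single_apply, mul_ite, mul_one, mul_zero]
  congr 1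
  rw [eq_iff_iff, Equiv.Perm.inv_eq_iff_eq, eq_comm]

theorem det_one_sub_reflB (w : WeylB n) :
    LinearMap.det (1 - reflB n w) = ∏ c : CycleClass w.right,
      (1 - ((∏ i with cycleClass w.right i = c, w.left i : ℤˣ) : ℤ) : ℝ) := by
  rw [← LinearMap.det_toMatrix', map_sub, toMatrix_reflB, LinearMap.toMatrix'_one,
    det_one_sub_weightedPermMatrix]
  refine Finset.prod_congr rfl fun c _ => ?_
  push_cast
  rfl

theorem toMatrix_one_sub_smul {R M ι : Type} [CommRing R] [AddCommGroup M] [Module R M] [Fintype ι]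
    [DecidableEq ι] (b : Module.Basis ι R M) (t : R) (f : Module.End R M) :
    LinearMap.toMatrix b b (1 - t • f) = 1 - t • LinearMap.toMatrix b b f := by
  rw [map_sub, map_smul, LinearMap.toMatrix_one]

theorem detOneSubQ_reflB (w : WeylB n) :
    detOneSubQ (reflB n) w = ∏ c : CycleClass w.right,
      (1 - C ((((∏ i with cycleClass w.right i = c, w.left i : ℤˣ) : ℤ)) : ℝ) *
        X ^ cycleLen w.right c) := by
  have h : LinearMap.toMatrix (Algebra.TensorProduct.basis ℝ[X] (Pi.basisFun ℝ (Fin n)))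
      (Algebra.TensorProduct.basis ℝ[X] (Pi.basisFun ℝ (Fin n)))
      (1 - (X : ℝ[X]) • (reflB n w).baseChange ℝ[X]) =
      1 - weightedPermMatrix w.right (fun i => X * C ((w.left i : ℤ) : ℝ)) := by
    refine (toMatrix_one_sub_smul _ _ _).trans ?_
    rw [LinearMap.toMatrix_baseChange,
      LinearMap.toMatrix_eq_toMatrix', toMatrix_reflB]
    congr 1
    ext i j
    simp [weightedPermMatrix, apply_ite]
  rw [detOneSubQ, ← LinearMap.det_toMatrix (Algebra.TensorProduct.basis ℝ[X] (Pi.basisFun ℝ (Fin n))), h,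
    det_one_sub_weightedPermMatrix]
  refine Finset.prod_congr rfl fun c _ => ?_
  rw [Finset.prod_mul_distrib, Finset.prod_const, mul_comm]
  push_cast
  rw [map_prod]
  rfl

/-- Averaging over the sign changes. -/
theorem sum_signs_det_div (g : Equiv.Perm (Fin n)) :
    ∑ ε : Fin n → ℤˣ, RatFunc.C (((LinearMap.det (1 - reflB n ⟨ε, g⟩) : ℝ)) : ℂ) /
      algebraMap ℂ[X] (RatFunc ℂ) ((detOneSubQ (reflB n) ⟨ε, g⟩).map Complex.ofRealHom) =
    2 ^ n * ∏ c : CycleClass g, (1 + RatFunc.X ^ cycleLen g c)⁻¹ := by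
  -- The contribution of a cycle with sign product `s`: it is `0` for `s = 1` and `2 / (1 + q^k)`
  -- for `s = -1`, with average `1 / (1 + q^k)`.
  let F : CycleClass g → ℤˣ → RatFunc ℂ := fun c s =>
    (1 - ((s : ℤ) : RatFunc ℂ)) / (1 - ((s : ℤ) : RatFunc ℂ) * RatFunc.X ^ cycleLen g c)
  have h := sum_signs_prod_classes (cycleClass g) (cycleClass_surjective g) F
  rw [Fintype.card_fin] at h
  refine Eq.trans (Finset.sum_congr rfl fun ε _ => ?_) (h.trans ?_)
  · rw [det_one_sub_reflB, detOneSubQ_reflB]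
    simp only [Polynomial.map_prod, map_prod, Complex.ofReal_prod, F, Finset.prod_div_distrib]
    congr 1
    · refine Finset.prod_congr rfl fun c _ => ?_
      generalize (∏ i with cycleClass g i = c, ε i) = s
      simp
    · refine Finset.prod_congr rfl fun c _ => ?_
      generalize (∏ i with cycleClass g i = c, ε i) = s
      simp
  · congr 1
    refine Finset.prod_congr rfl fun c _ => ?_
    simp only [F]
    norm_num
    field_simp

end Reflection

/-! ### Commuting actions of `S_n` and `gl_N` on tensor space; the Casimir operator -/

namespace TensorSpace

open MvPolynomial (monomial)

variable {n N : ℕ}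

local notation "𝓟" => MvPolynomial (Fin N) ℂ
local notation "ℂS" => MonoidAlgebra ℂ (Equiv.Perm (Fin n))

variable (n N) in
/-- The `n`-th tensor power of `R ^ N`, as functions on the set of colourings. -/
abbrev Space : Type := (Fin n → Fin N) → MvPolynomial (Fin N) ℂ

/-- Place permutations. -/
def permOp : Equiv.Perm (Fin n) →* Module.End 𝓟 (Space n N) where
  toFun g := LinearMap.funLeft 𝓟 𝓟 fun f : Fin n → Fin N => f ∘ g
  map_one' := rfl
  map_mul' _ _ := rfl

theorem permOp_apply (g : Equiv.Perm (Fin n)) (φ : Space n N) (f : Fin n → Fin N) :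
    permOp g φ f = φ (f ∘ g) := rfl

/-- The action of the group algebra by place permutations. -/
def symOp : ℂS →ₐ[ℂ] Module.End 𝓟 (Space n N) :=
  MonoidAlgebra.lift ℂ (Module.End 𝓟 (Space n N)) (Equiv.Perm (Fin n)) permOp

theorem symOp_of (g : Equiv.Perm (Fin n)) :
    symOp (N := N) (MonoidAlgebra.of ℂ _ g) = permOp g := by
  simp [symOp]

/-- The matrix unit `E_{ij}` of `gl_N`, acting on the tensor power. -/
def unitOp (i j : Fin N) : Module.End 𝓟 (Space n N) where
  toFun φ f := ∑ u, if f u = i then φ (Function.update f u j) else 0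
  map_add' φ ψ := by
    funext f
    simp only [Pi.add_apply, ← Finset.sum_add_distrib]
    exact Finset.sum_congr rfl fun u _ => by split_ifs <;> simp
  map_smul' c φ := by
    funext f
    simp only [Pi.smul_apply, RingHom.id_apply, smul_eq_mul, Finset.mul_sum, mul_ite, mul_zero]

theorem unitOp_apply (i j : Fin N) (φ : Space n N) (f : Fin n → Fin N) :
    unitOp i j φ f = ∑ u, if f u = i then φ (Function.update f u j) else 0 := rfl

/-- The monomial of a colouring. -/
def colorMonomial (f : Fin n → Fin N) : 𝓟 := ∏ u, MvPolynomial.X (f u)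

/-- The diagonal operator `diag(x_1, …, x_N)` on the tensor power. -/
def weightOp : Module.End 𝓟 (Space n N) where
  toFun φ f := colorMonomial f * φ f
  map_add' φ ψ := by funext f; simp [mul_add]
  map_smul' c φ := by funext f; simp [mul_left_comm]

theorem weightOp_apply (φ : Space n N) (f : Fin n → Fin N) :
    weightOp φ f = colorMonomial f * φ f := rfl

theorem permOp_mul_unitOp (g : Equiv.Perm (Fin n)) (i j : Fin N) :
    permOp g * unitOp i j = unitOp i j * permOp g := by
  refine LinearMap.ext fun φ => funext fun f => ?_
  simp only [Module.End.mul_apply, permOp_apply, unitOp_apply, Function.comp_apply]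
  refine Fintype.sum_equiv g _ _ fun u => ?_
  have : Function.update (f ∘ g) u j = Function.update f (g u) j ∘ g := by
    funext v
    by_cases h : v = u
    · simp [h]
    · simp [h, Function.update_of_ne]
  rw [this]

theorem symOp_mul_of_commute (A : Module.End 𝓟 (Space n N))
    (hA : ∀ g, permOp g * A = A * permOp g) (z : ℂS) : symOp z * A = A * symOp z := by
  induction z using MonoidAlgebra.induction_on with
  | of g => rw [symOp_of, hA]
  | add x y hx hy => rw [map_add, add_mul, mul_add, hx, hy]
  | smul r x hx => rw [map_smul, smul_mul_assoc, mul_smul_comm, hx]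

theorem symOp_mul_unitOp (z : ℂS) (i j : Fin N) :
    symOp z * unitOp i j = unitOp i j * symOp z :=
  symOp_mul_of_commute _ (fun g => permOp_mul_unitOp g i j) z

theorem colorMonomial_comp_perm (f : Fin n → Fin N) (g : Equiv.Perm (Fin n)) :
    colorMonomial (f ∘ g) = colorMonomial f :=
  Equiv.prod_comp g fun u => (MvPolynomial.X (f u) : 𝓟)

theorem symOp_mul_weightOp (z : ℂS) : symOp (N := N) z * weightOp = weightOp * symOp z := by
  refine symOp_mul_of_commute _ (fun g => ?_) z
  refine LinearMap.ext fun φ => funext fun f => ?_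
  simp only [Module.End.mul_apply, permOp_apply, weightOp_apply, colorMonomial_comp_perm]

theorem X_mul_colorMonomial_update (f : Fin n → Fin N) (u : Fin n) (j : Fin N) :
    MvPolynomial.X (f u) * colorMonomial (Function.update f u j) =
      MvPolynomial.X j * colorMonomial f := by
  rw [colorMonomial, colorMonomial, ← Finset.mul_prod_erase _ _ (Finset.mem_univ u),
    ← Finset.mul_prod_erase Finset.univ (fun v => (MvPolynomial.X (f v) : 𝓟)) (Finset.mem_univ u),
    Function.update_self, mul_left_comm]
  congr 2
  refine Finset.prod_congr rfl fun v hv => ?_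
  rw [Function.update_of_ne (Finset.ne_of_mem_erase hv)]

/-- Moving the generic diagonal matrix past `E_ij` costs the factor `x_j / x_i`; denominators are
cleared to stay in the polynomial ring. -/
theorem X_smul_unitOp_mul_weightOp (i j : Fin N) :
    (MvPolynomial.X i : 𝓟) • (unitOp (n := n) i j * weightOp) =
      (MvPolynomial.X j : 𝓟) • (weightOp * unitOp i j) := by
  refine LinearMap.ext fun φ => funext fun f => ?_
  simp only [LinearMap.smul_apply, Pi.smul_apply, Module.End.mul_apply, weightOp_apply,
    unitOp_apply, smul_eq_mul, Finset.mul_sum]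
  refine Finset.sum_congr rfl fun u _ => ?_
  by_cases h : f u = i
  · subst h
    rw [if_pos rfl, if_pos rfl, ← mul_assoc, X_mul_colorMonomial_update, mul_assoc]
  · simp [h]

/-- Recolouring `u` from `i` to `j` and then some `v` from `j` to `i` interchanges the colours of
`u` and `v`. The case `v = u` undoes the first change and is the identity. -/
theorem unitOp_mul_unitOp (i j : Fin N) (φ : Space n N) (f : Fin n → Fin N) :
    unitOp i j (unitOp j i φ) f =
      ∑ u, ∑ v, if f u = i ∧ (v = u ∨ f v = j) then φ (f ∘ Equiv.swap u v) else 0 := by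
  simp only [unitOp_apply]
  refine Finset.sum_congr rfl fun u _ => ?_
  by_cases hu : f u = i
  · rw [if_pos hu]
    refine Finset.sum_congr rfl fun v _ => ?_
    by_cases hv : v = u
    · subst hv
      simp [hu]
      rw [← hu, Function.update_eq_self]
    · rw [Function.update_of_ne hv]
      by_cases hj : f v = j
      · rw [if_pos hj, if_pos ⟨hu, Or.inr hj⟩]
        congr 1
        funext w
        by_cases hwv : w = v
        · subst hwv; simp [hu]
        · by_cases hwu : w = u
          · subst hwu; simp [hwv, hj]
          · simp [hwv, hwu, Equiv.swap_apply_of_ne_of_ne]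
      · rw [if_neg hj, if_neg (by tauto)]
  · simp [hu]

/-- The number of boxes of colour `i`. -/
def colorCount (f : Fin n → Fin N) (i : Fin N) : ℕ := (Finset.univ.filter fun u => f u = i).card

theorem unitOp_diag (i : Fin N) (φ : Space n N) (f : Fin n → Fin N) :
    unitOp i i φ f = (colorCount f i : 𝓟) * φ f := by
  rw [unitOp_apply, colorCount, ← nsmul_eq_mul, ← Finset.sum_const, Finset.sum_filter]
  refine Finset.sum_congr rfl fun u _ => ?_
  split_ifs with h
  · rw [← h, Function.update_eq_self]
  · rfl

/-- In the two products the terms with `u ≠ v` agree after exchanging `u` and `v`; the terms with `u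
= v` count the boxes of colours `i` and `j`. -/
theorem unitOp_commutator (i j : Fin N) :
    unitOp (n := n) i j * unitOp j i - unitOp j i * unitOp i j =
      unitOp i i - unitOp j j := by
  refine LinearMap.ext fun φ => funext fun f => ?_
  simp only [LinearMap.sub_apply, Pi.sub_apply, Module.End.mul_apply, unitOp_mul_unitOp]
  rw [Finset.sum_comm (f := fun u v => if f u = j ∧ (v = u ∨ f v = i) then
    φ (f ∘ Equiv.swap u v) else 0)]
  have hsplit : ∀ i j : Fin N, ∀ u v : Fin n, (if f u = i ∧ (v = u ∨ f v = j) then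
      φ (f ∘ Equiv.swap u v) else 0) = (if v = u then if f u = i then φ f else 0 else 0) +
      (if v ≠ u then if f u = i ∧ f v = j then φ (f ∘ Equiv.swap u v) else 0 else 0) := by
    intro i j u v
    by_cases h : v = u
    · subst h; simp
    · simp [h]
  simp only [hsplit, Finset.sum_add_distrib, Finset.sum_ite_eq', Finset.sum_ite_eq,
    Finset.mem_univ, if_true]
  have h2 : ∀ u v : Fin n, (if u ≠ v then if f v = j ∧ f u = i then φ (f ∘ Equiv.swap v u)
      else 0 else 0) = (if v ≠ u then if f u = i ∧ f v = j then φ (f ∘ Equiv.swap u v)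
      else 0 else 0) := fun u v => by
    simp only [ne_comm (a := u), and_comm (a := f v = j), Equiv.swap_comm v u]
  simp only [h2, unitOp_apply]
  have h3 : ∀ i : Fin N, ∀ u : Fin n, (if f u = i then φ (Function.update f u i) else 0) =
      if f u = i then φ f else 0 := fun i u => by
    split_ifs with h
    · rw [← h, Function.update_eq_self]
    · rfl
  simp only [h3]
  abel

variable (n) in
/-- The sum over all ordered pairs of distinct letters of the transpositions. -/
def transpositionSum : MonoidAlgebra ℂ (Equiv.Perm (Fin n)) :=
  ∑ u, ∑ v, if v = u then 0 else MonoidAlgebra.of ℂ _ (Equiv.swap u v)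

theorem transpositionSum_central (z : ℂS) :
    z * transpositionSum n = transpositionSum n * z := by
  induction z using MonoidAlgebra.induction_on with
  | of g =>
    simp only [transpositionSum, Finset.mul_sum, Finset.sum_mul, mul_ite, ite_mul, mul_zero,
      zero_mul, ← map_mul]
    refine Fintype.sum_equiv g _ _ fun u => Fintype.sum_equiv g _ _ fun v => ?_
    simp only [g.injective.eq_iff]
    rw [Equiv.swap_apply_apply]
    simp [mul_assoc]
  | add x y hx hy => rw [add_mul, mul_add, hx, hy]
  | smul r x hx => rw [smul_mul_assoc, mul_smul_comm, hx]

/-- The Casimir operator is given by the transpositions. -/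
theorem sum_unitOp_mul_unitOp :
    ∑ i : Fin N, ∑ j : Fin N, unitOp (n := n) i j * unitOp j i =
      symOp (transpositionSum n) + ((n * N : ℕ) : Module.End 𝓟 (Space n N)) := by
  refine LinearMap.ext fun φ => funext fun f => ?_
  have h1 : symOp (transpositionSum n) φ f =
      ∑ u, ∑ v, if v = u then 0 else φ (f ∘ Equiv.swap u v) := by
    simp only [transpositionSum, map_sum, apply_ite (symOp (n := n) (N := N)), symOp_of, map_zero,
      LinearMap.sum_apply, Finset.sum_apply]
    refine Finset.sum_congr rfl fun u _ => Finset.sum_congr rfl fun v _ => ?_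
    split_ifs
    · rfl
    · rfl
  simp only [LinearMap.add_apply, Pi.add_apply, h1, LinearMap.sum_apply, Finset.sum_apply,
    Module.End.mul_apply, unitOp_mul_unitOp]
  have h2 : ∀ i, ∑ j, ∑ u, ∑ v, (if f u = i ∧ (v = u ∨ f v = j) then φ (f ∘ Equiv.swap u v)
      else 0) = ∑ u, ∑ v, ∑ j, (if f u = i ∧ (v = u ∨ f v = j) then φ (f ∘ Equiv.swap u v)
      else 0) := fun i => by
    rw [Finset.sum_comm]
    exact Finset.sum_congr rfl fun u _ => Finset.sum_comm
  simp only [h2]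
  rw [Finset.sum_comm]
  -- The colour `i` must be `f u`. For `v ≠ u` also `j = f v` is forced, giving one transposition;
  -- for `v = u` all `N` values of `j` are allowed, which produces the scalar `n N`.
  have h3 : ∀ u, ∑ i, ∑ v, ∑ j, (if f u = i ∧ (v = u ∨ f v = j) then φ (f ∘ Equiv.swap u v)
      else 0) = ∑ v, ((if v = u then 0 else φ (f ∘ Equiv.swap u v)) +
        if v = u then (N : 𝓟) * φ f else 0) := fun u => by
    rw [Finset.sum_comm]
    refine Finset.sum_congr rfl fun v _ => ?_
    rw [Finset.sum_eq_single (f u) (fun i _ hi => by simp [hi.symm]) (by simp)]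
    by_cases h : v = u
    · subst h; simp
    · simp [h]
  simp only [h3, Finset.sum_add_distrib, Finset.sum_ite_eq', Finset.mem_univ, if_true]
  rw [Finset.sum_const, Finset.card_univ, Fintype.card_fin, Module.End.natCast_apply]
  simp [mul_assoc]

/-! ### Characteristic polynomials as traces, and their Euler derivatives -/

theorem trace_eq_sum (A : Module.End 𝓟 (Space n N)) :
    LinearMap.trace 𝓟 _ A = ∑ f, A (Pi.single f 1) f := by
  rw [LinearMap.trace_eq_matrix_trace 𝓟 (Pi.basisFun 𝓟 _), Matrix.trace]
  refine Finset.sum_congr rfl fun f _ => ?_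
  rw [Matrix.diag_apply, LinearMap.toMatrix_apply]
  simp

/-- The number of colourings fixed by a group algebra element, with multiplicities. -/
def fixMult (z : ℂS) (f : Fin n → Fin N) : ℂ :=
  ∑ g, z.coeff g * if f ∘ g = f then 1 else 0

theorem symOp_single (z : ℂS) (f : Fin n → Fin N) :
    symOp z (Pi.single f (1 : 𝓟)) f = MvPolynomial.C (fixMult z f) := by
  rw [symOp, MonoidAlgebra.lift_apply, Finsupp.sum_fintype _ _ (by simp), LinearMap.sum_apply,
    Finset.sum_apply, fixMult, map_sum]
  refine Finset.sum_congr rfl fun g _ => ?_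
  rw [LinearMap.smul_apply, Pi.smul_apply, permOp_apply, Pi.single_apply, map_mul,
    MvPolynomial.smul_eq_C_mul]
  split_ifs <;> simp

/-- The exponent vector of the monomial of a colouring. -/
def colorExp (f : Fin n → Fin N) : Fin N →₀ ℕ := ∑ u, Finsupp.single (f u) 1

theorem colorExp_apply (f : Fin n → Fin N) (i : Fin N) : colorExp f i = colorCount f i := by
  rw [colorExp, Finsupp.finsetSum_apply, colorCount, Finset.card_filter]
  exact Finset.sum_congr rfl fun u _ => by rw [Finsupp.single_apply]

theorem colorMonomial_eq (f : Fin n → Fin N) : colorMonomial f = monomial (colorExp f) 1 := by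
  rw [colorMonomial, colorExp, MvPolynomial.monomial_sum_one]
  rfl

/-- The characteristic polynomial `∑ z(g) p_g` of a group algebra element. -/
def charPoly (N : ℕ) (z : ℂS) : MvPolynomial (Fin N) ℂ :=
  ∑ f : Fin n → Fin N, monomial (colorExp f) (fixMult z f)

theorem trace_weightOp_mul_symOp (z : ℂS) :
    LinearMap.trace 𝓟 _ (weightOp * symOp z) = charPoly N z := by
  rw [trace_eq_sum, charPoly]
  refine Finset.sum_congr rfl fun f _ => ?_
  rw [Module.End.mul_apply, weightOp_apply, symOp_single, colorMonomial_eq, mul_comm,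
    MvPolynomial.C_mul_monomial, mul_one]

/-- Cyclicity of the trace, as place permutations commute with `weightOp`. It allows `rowSum *
colSum` to be traded for `colSum * rowSum`, whose coefficients are antisymmetric under left
multiplication by column permutations. -/
theorem charPoly_mul_comm (z w : ℂS) : charPoly N (z * w) = charPoly N (w * z) := by
  rw [← trace_weightOp_mul_symOp, ← trace_weightOp_mul_symOp, map_mul symOp, map_mul symOp,
    ← mul_assoc,
    LinearMap.trace_mul_comm, ← mul_assoc, symOp_mul_weightOp, mul_assoc]

/-- The Euler operator `x_i ∂_i`. -/
def euler (i : Fin N) : Derivation ℂ 𝓟 𝓟 := (MvPolynomial.X i : 𝓟) • MvPolynomial.pderiv i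

theorem euler_monomial (i : Fin N) (s : Fin N →₀ ℕ) (c : ℂ) :
    euler i (monomial s c) = (s i : 𝓟) * monomial s c := by
  rw [euler, Derivation.smul_apply, smul_eq_mul, MvPolynomial.X_mul_pderiv_monomial, nsmul_eq_mul]

theorem coeff_euler (i : Fin N) (p : 𝓟) (s : Fin N →₀ ℕ) :
    (euler i p).coeff s = s i * p.coeff s := by
  classical
  induction p using MvPolynomial.induction_on' with
  | monomial t c =>
    rw [euler_monomial, ← map_natCast (MvPolynomial.C (σ := Fin N) (R := ℂ)),
      MvPolynomial.coeff_C_mul, MvPolynomial.coeff_monomial]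
    split_ifs with h
    · rw [h]
    · simp
  | add p q hp hq => rw [map_add, MvPolynomial.coeff_add, MvPolynomial.coeff_add, hp, hq, mul_add]

theorem unitOp_single (i : Fin N) (f : Fin n → Fin N) :
    unitOp i i (Pi.single f 1) = (colorCount f i : 𝓟) • (Pi.single f 1 : Space n N) := by
  funext f'
  rw [unitOp_diag, Pi.smul_apply, smul_eq_mul]
  by_cases h : f' = f
  · rw [h]
  · simp [h]

/-- Both `x_i ∂_i` on the monomial of a colouring and `E_ii` on its basis vector multiply by the
number of letters of colour `i`. -/
theorem euler_charPoly (i : Fin N) (z : ℂS) :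
    euler i (charPoly N z) = LinearMap.trace 𝓟 _ (weightOp * symOp z * unitOp i i) := by
  rw [trace_eq_sum, charPoly, map_sum]
  refine Finset.sum_congr rfl fun f _ => ?_
  rw [euler_monomial, Module.End.mul_apply, unitOp_single, map_smul, Pi.smul_apply,
    Module.End.mul_apply, weightOp_apply, symOp_single, colorMonomial_eq, smul_eq_mul,
    mul_comm (MvPolynomial.monomial _ _), MvPolynomial.C_mul_monomial, mul_one, colorExp_apply]

theorem euler_euler_charPoly (i : Fin N) (z : ℂS) :
    euler i (euler i (charPoly N z)) =
      LinearMap.trace 𝓟 _ (weightOp * symOp z * (unitOp i i * unitOp i i)) := by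
  rw [trace_eq_sum, charPoly, map_sum, map_sum]
  refine Finset.sum_congr rfl fun f _ => ?_
  rw [euler_monomial, Module.End.mul_apply, Module.End.mul_apply, Module.End.mul_apply,
    unitOp_single, map_smul, unitOp_single]
  simp only [map_smul, Pi.smul_apply, smul_eq_mul]
  rw [weightOp_apply, symOp_single, colorMonomial_eq, mul_comm (MvPolynomial.monomial _ _),
    MvPolynomial.C_mul_monomial, mul_one, colorExp_apply, Derivation.leibniz, euler_monomial,
    colorExp_apply, Derivation.map_natCast]
  simp

/-- Euler's identity: the polynomial is homogeneous of degree `n`. -/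
theorem sum_euler_charPoly (z : ℂS) :
    ∑ i, euler i (charPoly N z) = (n : 𝓟) * charPoly N z := by
  simp only [charPoly, map_sum]
  rw [Finset.sum_comm, Finset.mul_sum]
  refine Finset.sum_congr rfl fun f _ => ?_
  simp only [euler_monomial, ← Finset.sum_mul, colorExp_apply, ← Nat.cast_sum]
  congr 2
  simp only [colorCount]
  rw [← Finset.card_eq_sum_card_fiberwise (fun _ _ => Finset.mem_coe.2 (Finset.mem_univ _)),
    Finset.card_univ, Fintype.card_fin]

end TensorSpace

/-! ### Alternants and the radial part of the Casimir operator -/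

namespace TensorSpace

variable {n N : ℕ}

local notation "𝓟" => MvPolynomial (Fin N) ℂ
local notation "ℂS" => MonoidAlgebra ℂ (Equiv.Perm (Fin n))

/-- The alternant `det (x_i ^ (L j))`. -/
def alternant (L : Fin N →₀ ℕ) : 𝓟 :=
  (Matrix.of fun i j => (MvPolynomial.X i : 𝓟) ^ L j).det

theorem alternant_eq (L : Fin N →₀ ℕ) :
    alternant L = ∑ σ : Equiv.Perm (Fin N),
      MvPolynomial.monomial (L.mapDomain σ) ((Equiv.Perm.sign σ : ℤ) : ℂ) := by
  rw [alternant, Matrix.det_apply]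
  refine Finset.sum_congr rfl fun σ _ => ?_
  rw [MvPolynomial.monomial_eq, Finsupp.prod_fintype _ _ (by simp), Units.smul_def, zsmul_eq_mul]
  have h : ∏ i, (MvPolynomial.X i : 𝓟) ^ L.mapDomain σ i = ∏ i, MvPolynomial.X (σ i) ^ L i := by
    rw [← Equiv.prod_comp σ]
    simp only [Finsupp.mapDomain_apply σ.injective]
  rw [h]
  simp

/-- The exponent `(0, 1, …, N - 1)`. -/
def staircase (N : ℕ) : Fin N →₀ ℕ := Finsupp.equivFunOnFinite.symm fun j => j

theorem staircase_apply (j : Fin N) : staircase N j = j := rfl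

/-- The exponents of all monomials are rearrangements of `L` and share its sum of squares. -/
theorem sum_euler_euler_alternant (L : Fin N →₀ ℕ) :
    ∑ i, euler i (euler i (alternant L)) = ((∑ i, L i ^ 2 : ℕ) : 𝓟) * alternant L := by
  simp only [alternant_eq, map_sum]
  rw [Finset.sum_comm, Finset.mul_sum]
  refine Finset.sum_congr rfl fun σ _ => ?_
  have h : ∀ (s : Fin N →₀ ℕ) (a : ℂ) (i : Fin N), euler i (euler i (MvPolynomial.monomial s a)) =
      ((s i ^ 2 : ℕ) : 𝓟) * MvPolynomial.monomial s a := fun s a i => by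
    rw [euler_monomial, Derivation.leibniz, Derivation.map_natCast, euler_monomial]
    rw [smul_zero, add_zero, smul_eq_mul]
    push_cast
    ring
  simp only [h, ← Finset.sum_mul, ← Nat.cast_sum]
  congr 2
  rw [← Equiv.sum_comp σ]
  simp only [Finsupp.mapDomain_apply σ.injective]

theorem derivation_prod {ι A : Type} [CommRing A] [Algebra ℂ A] [DecidableEq ι]
    (D : Derivation ℂ A A) (s : Finset ι) (f : ι → A) :
    D (∏ p ∈ s, f p) = ∑ p ∈ s, (∏ p' ∈ s.erase p, f p') * D (f p) := by
  induction s using Finset.induction_on with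
  | empty => simp
  | insert a s ha ih =>
    rw [Finset.prod_insert ha, Finset.sum_insert ha, Finset.erase_insert ha, Derivation.leibniz, ih,
      smul_eq_mul, smul_eq_mul, add_comm, Finset.mul_sum]
    congr 1
    refine Finset.sum_congr rfl fun p hp => ?_
    have : a ≠ p := fun h => ha (h ▸ hp)
    rw [Finset.erase_insert_of_ne this, Finset.prod_insert (fun h => ha (Finset.mem_of_mem_erase h)),
      mul_assoc]

/-- The ordered pairs of indices. -/
def pairs (N : ℕ) : Finset (Fin N × Fin N) := Finset.univ.filter fun p => p.1 < p.2

theorem alternant_staircase :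
    alternant (staircase N) = ∏ p ∈ pairs N, ((MvPolynomial.X p.2 : 𝓟) - MvPolynomial.X p.1) := by
  have h : alternant (staircase N) = (Matrix.vandermonde (MvPolynomial.X : Fin N → 𝓟)).det := rfl
  rw [h, Matrix.det_vandermonde, pairs, Finset.prod_filter, Fintype.prod_prod_type]
  refine Finset.prod_congr rfl fun i _ => ?_
  rw [← Finset.prod_filter]
  congr 1
  ext j
  simp

theorem euler_X (k i : Fin N) :
    euler k (MvPolynomial.X i : 𝓟) = if i = k then MvPolynomial.X i else 0 := by
  rw [euler, Derivation.smul_apply, MvPolynomial.pderiv_X, smul_eq_mul]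
  by_cases h : i = k
  · subst h; simp
  · rw [if_neg h, Pi.single_eq_of_ne h, mul_zero]

theorem sum_pairs_add {A : Type} [CommRing A] (g : Fin N → Fin N → A) :
    ∑ p ∈ pairs N, (g p.1 p.2 + g p.2 p.1) = ∑ i, ∑ j, g i j - ∑ i, g i i := by
  have h1 : ∑ p ∈ pairs N, g p.2 p.1 = ∑ p : Fin N × Fin N with p.2 < p.1, g p.1 p.2 := by
    refine Finset.sum_bij' (fun p _ => p.swap) (fun p _ => p.swap) ?_ ?_ ?_ ?_ ?_ <;>
      simp [pairs]
  rw [Finset.sum_add_distrib, h1, pairs, Finset.sum_filter, Finset.sum_filter,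
    ← Finset.sum_add_distrib, Fintype.sum_prod_type, ← Finset.sum_sub_distrib]
  refine Finset.sum_congr rfl fun i _ => ?_
  have hi : g i i = ∑ j, if i = j then g i j else 0 := by simp
  rw [eq_sub_iff_add_eq, hi, ← Finset.sum_add_distrib]
  refine Finset.sum_congr rfl fun j _ => ?_
  rcases lt_trichotomy i j with h | h | h
  · simp [h, h.not_gt, h.ne]
  · simp [h]
  · simp [h, h.not_gt, h.ne']

/-- Put `t i j = tr(D z E_ij E_ji)`, with `D` the diagonal matrix. Cyclicity of the trace (`h1`) and
the commutator (`h2`) are two linear relations between `t i j` and `t j i`, which express them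
through the first derivatives `θ`. Because of this, the cross terms of `∑ (x_i ∂_i)^2` on `V * F`
are exactly the off-diagonal Casimir terms times `V`, up to first-order terms that sum to multiples
of `F` by homogeneity. The whole Casimir acts by a scalar by `hz`. -/
theorem exists_casimir (z : ℂS) (c : ℂ) (hz : z * transpositionSum n = c • z) :
    ∃ e : ℂ, ∑ i, euler i (euler i (alternant (staircase N) * charPoly N z)) =
      MvPolynomial.C e * (alternant (staircase N) * charPoly N z) := by
  set V : 𝓟 := alternant (staircase N) with hV
  set F : 𝓟 := charPoly N z with hF
  let S : Module.End 𝓟 (Space n N) := symOp z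
  let θ : Fin N → 𝓟 := fun i => euler i F
  let t : Fin N → Fin N → 𝓟 := fun i j =>
    LinearMap.trace 𝓟 _ (weightOp * S * (unitOp i j * unitOp j i))
  have h1 : ∀ i j, MvPolynomial.X j * t i j = MvPolynomial.X i * t j i := fun i j => by
    have e1 : t i j = LinearMap.trace 𝓟 _ ((unitOp j i * weightOp) * (S * unitOp i j)) := by
      show LinearMap.trace 𝓟 _ (weightOp * S * (unitOp i j * unitOp j i)) = _
      rw [← mul_assoc, LinearMap.trace_mul_comm]
      simp only [mul_assoc]
    have e2 : t j i = LinearMap.trace 𝓟 _ ((weightOp * unitOp j i) * (S * unitOp i j)) := by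
      show LinearMap.trace 𝓟 _ (weightOp * S * (unitOp j i * unitOp i j)) = _
      rw [mul_assoc, mul_assoc, ← mul_assoc S, symOp_mul_unitOp, mul_assoc]
    have e3 := congrArg (fun A => LinearMap.trace 𝓟 _ (A * (S * unitOp i j)))
      (X_smul_unitOp_mul_weightOp (n := n) j i)
    simp only [smul_mul_assoc, map_smul, smul_eq_mul] at e3
    rw [e1, e2, e3]
  have h2 : ∀ i j, t i j - t j i = θ i - θ j := fun i j => by
    show LinearMap.trace 𝓟 _ _ - LinearMap.trace 𝓟 _ _ = euler i F - euler j F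
    rw [hF, euler_charPoly, euler_charPoly, ← map_sub, ← mul_sub, unitOp_commutator, ← map_sub,
      ← mul_sub]
  have h3 : ∑ i, ∑ j, t i j = MvPolynomial.C c * F + ((n * N : ℕ) : 𝓟) * F := by
    simp only [t, ← map_sum, ← Finset.mul_sum]
    rw [sum_unitOp_mul_unitOp, mul_add, mul_assoc, ← map_mul symOp, hz, map_add, ← nsmul_eq_mul',
      map_smul symOp, mul_smul_comm, map_nsmul, trace_weightOp_mul_symOp, nsmul_eq_mul]
    congr 1
    rw [hF, ← trace_weightOp_mul_symOp z]
    have : c • (weightOp * symOp z : Module.End 𝓟 (Space n N)) =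
      (MvPolynomial.C c : 𝓟) • (weightOp * symOp z) := by
      refine LinearMap.ext fun φ => funext fun f => ?_
      simp only [LinearMap.smul_apply, Pi.smul_apply, MvPolynomial.smul_eq_C_mul, smul_eq_mul]
    rw [this, map_smul, smul_eq_mul]
  have h4 : ∀ i, euler i (euler i F) = t i i := fun i => euler_euler_charPoly i z
  have h5 : ∑ i, θ i = (n : 𝓟) * F := sum_euler_charPoly z
  -- The factor `x_j - x_i` on the right restores the factor of `V` that the derivative removed.
  have h6 : ∀ i j, MvPolynomial.X j * θ j - MvPolynomial.X i * θ i =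
      ((MvPolynomial.X j : 𝓟) - MvPolynomial.X i) * (t j i + θ i) := fun i j => by
    linear_combination (MvPolynomial.X j : 𝓟) * (- h2 j i) - h1 i j
  have h7 : ∑ k, euler k V * θ k = V * ∑ p ∈ pairs N, (t p.2 p.1 + θ p.1) := by
    have : ∀ k, euler k V * θ k = ∑ p ∈ pairs N,
        (∏ p' ∈ (pairs N).erase p, ((MvPolynomial.X p'.2 : 𝓟) - MvPolynomial.X p'.1)) *
          ((if p.2 = k then MvPolynomial.X p.2 else 0) -
            (if p.1 = k then MvPolynomial.X p.1 else 0)) * θ k := fun k => by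
      rw [hV, alternant_staircase, derivation_prod, Finset.sum_mul]
      simp only [map_sub, euler_X]
    simp only [this]
    rw [Finset.sum_comm, Finset.mul_sum]
    refine Finset.sum_congr rfl fun p hp => ?_
    simp only [mul_assoc, ← Finset.mul_sum, sub_mul, Finset.sum_sub_distrib, ite_mul, zero_mul,
      Finset.sum_ite_eq, Finset.mem_univ, if_true]
    rw [h6, ← mul_assoc, hV, alternant_staircase, Finset.prod_erase_mul _ _ hp]
  have h8 : 2 * ∑ p ∈ pairs N, (t p.2 p.1 + θ p.1) =
      ∑ i, ∑ j, (t i j + θ i) - ∑ i, (t i i + θ i) := by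
    rw [← sum_pairs_add (fun i j => t i j + θ i), Finset.mul_sum]
    refine Finset.sum_congr rfl fun p _ => ?_
    linear_combination h2 p.2 p.1
  have h9 : ∑ i, ∑ j, (t i j + θ i) = MvPolynomial.C c * F + ((n * N : ℕ) : 𝓟) * F +
      (N : 𝓟) * ((n : 𝓟) * F) := by
    simp only [Finset.sum_add_distrib, h3, Finset.sum_const, Finset.card_univ, Fintype.card_fin,
      nsmul_eq_mul, ← Finset.mul_sum, h5]
  have h10 : ∑ i, (t i i + θ i) = ∑ i, t i i + (n : 𝓟) * F := by
    rw [Finset.sum_add_distrib, h5]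
  have h11 := sum_euler_euler_alternant (staircase N)
  rw [← hV] at h11
  have h12 : ∑ i, euler i (euler i (V * F)) =
      V * ∑ i, t i i + 2 * (∑ i, euler i V * θ i) + (∑ i, euler i (euler i V)) * F := by
    rw [Finset.mul_sum, Finset.mul_sum, Finset.sum_mul, ← Finset.sum_add_distrib,
      ← Finset.sum_add_distrib]
    refine Finset.sum_congr rfl fun i _ => ?_
    simp only [Derivation.leibniz, map_add, smul_eq_mul, h4, θ]
    ring
  -- The Casimir gives `c + n N`, the first-order terms of `h8` give `N n - n`, and the sum of
  -- squares is the eigenvalue of `V` itself.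
  refine ⟨c + 2 * n * N - n + (∑ i, staircase N i ^ 2 : ℕ), ?_⟩
  rw [h12, h7, h11]
  have hcast : ∀ k : ℕ, (k : 𝓟) = MvPolynomial.C (k : ℂ) := fun k => by simp
  simp only [map_add, map_sub, map_mul, ← hcast]
  rw [h9, h10] at h8
  have h2C : (MvPolynomial.C (2 : ℂ) : 𝓟) = 2 := map_ofNat _ _
  rw [h2C]
  push_cast at h8 ⊢
  linear_combination V * h8

end TensorSpace

/-! ### Dominance through layers -/

section Layers

variable {N : ℕ}

/-- Layer-cake summation: `β j` is the number of `t` with `t < β j`, so pairing with `β` is a sum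
over its superlevel sets. -/
theorem sum_mul_le_sum_mul_of_layers (β γ δ : Fin N → ℕ)
    (h : ∀ t, ∑ j with t < β j, γ j ≤ ∑ j with t < β j, δ j) :
    ∑ j, β j * γ j ≤ ∑ j, β j * δ j := by
  have key : ∀ γ : Fin N → ℕ, ∑ j, β j * γ j =
      ∑ t ∈ Finset.range (∑ j, β j), ∑ j with t < β j, γ j := fun γ => by
    simp only [Finset.sum_filter]
    rw [Finset.sum_comm]
    refine Finset.sum_congr rfl fun j _ => ?_
    have hle : β j ≤ ∑ j, β j := Finset.single_le_sum (fun _ _ => Nat.zero_le _) (Finset.mem_univ j)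
    rw [← Finset.sum_filter, Finset.sum_const, smul_eq_mul]
    congr 1
    have : (Finset.range (∑ j, β j)).filter (fun t => t < β j) = Finset.range (β j) := by
      ext t
      simp only [Finset.mem_filter, Finset.mem_range]
      omega
    rw [this, Finset.card_range]
  rw [key, key]
  exact Finset.sum_le_sum fun t _ => h t

/-- The hypotheses give `|β - γ|² = 2 |β|² - 2 ⟨β, γ⟩ ≤ 0`. -/
theorem eq_of_sum_sq_eq_of_le (β γ : Fin N → ℕ) (h1 : ∑ j, β j ^ 2 = ∑ j, γ j ^ 2)
    (h2 : ∑ j, β j * β j ≤ ∑ j, β j * γ j) : β = γ := by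
  have h3 : ∑ j, ((β j : ℤ) - γ j) ^ 2 ≤ 0 := by
    have e : ∑ j, ((β j : ℤ) - γ j) ^ 2 =
        ((∑ j, β j ^ 2 : ℕ) : ℤ) + ((∑ j, γ j ^ 2 : ℕ) : ℤ) - 2 * ((∑ j, β j * γ j : ℕ) : ℤ) := by
      push_cast
      rw [Finset.mul_sum, ← Finset.sum_add_distrib, ← Finset.sum_sub_distrib]
      exact Finset.sum_congr rfl fun j _ => by ring
    have h4 : ∑ j, β j * β j = ∑ j, β j ^ 2 := Finset.sum_congr rfl fun j _ => (pow_two _).symm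
    rw [e, ← h1]
    rw [h4] at h2
    omega
  have h5 := (Finset.sum_eq_zero_iff_of_nonneg (fun j _ => sq_nonneg ((β j : ℤ) - γ j))).1
    (le_antisymm h3 (Finset.sum_nonneg fun j _ => sq_nonneg _))
  funext j
  have := pow_eq_zero_iff (two_ne_zero) |>.1 (h5 j (Finset.mem_univ j))
  omega

/-- Rearrangement inequality for the indicator of the layer, an upper set because `β` is sorted. -/
theorem sum_perm_layer_le (σ : Equiv.Perm (Fin N)) (β : Fin N → ℕ) (hβ : Monotone β) (t : ℕ) :
    ∑ j with t < β j, ((σ j : Fin N) : ℕ) ≤ ∑ j with t < β j, (j : ℕ) := by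
  have hm : Monovary (fun j => if t < β j then 1 else 0) (fun j : Fin N => (j : ℕ)) := by
    intro i j hij
    have := hβ (Fin.lt_def.2 hij).le
    dsimp only
    split_ifs <;> omega
  have := hm.sum_mul_comp_perm_le_sum_mul (σ := σ)
  simpa [Finset.sum_filter] using this

/-- A layer of a sorted `β` is a final segment of the indices, which reversal turns into an initial
segment. -/
theorem sum_rev_layer (lam : ℕ → ℕ) (β : Fin N → ℕ) (hβ : Monotone β) (t : ℕ) :
    ∑ j with t < β j, lam (N - 1 - j) =
      ∑ k ∈ Finset.range (Finset.univ.filter fun j => t < β j).card, lam k := by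
  set S := Finset.univ.filter fun j => t < β j with hS
  have hinj : Set.InjOn (fun j : Fin N => N - 1 - (j : ℕ)) S := by
    intro i _ j _ h
    ext
    have := i.2
    have := j.2
    simp only at h
    omega
  have himg : S.image (fun j : Fin N => N - 1 - (j : ℕ)) = Finset.range S.card := by
    refine Finset.eq_of_subset_of_card_le ?_ ?_
    · intro k hk
      obtain ⟨j, hj, rfl⟩ := Finset.mem_image.1 hk
      have hsub : Finset.Ici j ⊆ S := fun i hi => by
        have h1 := (Finset.mem_filter.1 hj).2
        have h2 := hβ (Finset.mem_Ici.1 hi)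
        rw [hS, Finset.mem_filter]
        exact ⟨Finset.mem_univ _, h1.trans_le h2⟩
      have := Finset.card_le_card hsub
      rw [Fin.card_Ici] at this
      rw [Finset.mem_range]
      have := j.2
      omega
    · rw [Finset.card_range, Finset.card_image_of_injOn hinj]
  rw [← himg, Finset.sum_image hinj]

end Layers

/-! ### The Frobenius formula up to its leading coefficient -/

namespace YoungDiagram

open TensorSpace

variable {μ : YoungDiagram} {n N : ℕ} {T : μ.Numbering n}

local notation "𝓟" => MvPolynomial (Fin N) ℂ

theorem coeff_colSum_mul {q : Equiv.Perm (Fin n)} (hq : ColStab T q) (z : MonoidAlgebra ℂ _)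
    (x : Equiv.Perm (Fin n)) :
    (colSum T * z).coeff (q⁻¹ * x) = ((Equiv.Perm.sign q : ℤ) : ℂ) * (colSum T * z).coeff x := by
  have h := congrArg (fun w => (w * z).coeff x) (of_mul_colSum hq)
  simp only [mul_assoc, MonoidAlgebra.of_apply, MonoidAlgebra.coeff_single_mul_apply, one_mul,
    smul_mul_assoc, MonoidAlgebra.coeff_smul_apply, smul_eq_mul] at h
  exact h

/-- Left multiplication by the transposition of two equally coloured boxes of a column preserves the
condition that `g` fixes `f` and negates the coefficient. -/
theorem fixMult_eq_zero {f : Fin n → Fin N} (hf : ¬ ColInjective T f) (z : MonoidAlgebra ℂ _) :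
    fixMult (colSum T * z) f = 0 := by
  obtain ⟨u, v, hne, hcol, huv⟩ := (ColInjective.or_exists_swap f).resolve_left hf
  have hs : f ∘ Equiv.swap u v = f := by
    funext w
    rw [Function.comp_apply]
    by_cases hwu : w = u
    · rw [hwu, Equiv.swap_apply_left, huv]
    · by_cases hwv : w = v
      · rw [hwv, Equiv.swap_apply_right, huv]
      · rw [Equiv.swap_apply_of_ne_of_ne hwu hwv]
  have h : fixMult (colSum T * z) f = - fixMult (colSum T * z) f := by
    conv_rhs => rw [fixMult, ← Finset.sum_neg_distrib]
    refine Fintype.sum_equiv (Equiv.mulLeft (Equiv.swap u v)) _ _ fun g => ?_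
    have h1 := coeff_colSum_mul (ColStab.swap hcol) z g
    rw [Equiv.Perm.sign_swap hne, Equiv.swap_inv] at h1
    have h2 : f ∘ ⇑(Equiv.swap u v * g) = f ∘ g := by
      rw [Equiv.Perm.coe_mul, ← Function.comp_assoc, hs]
    rw [Equiv.coe_mulLeft, h1, h2]
    simp only [Units.val_neg, Units.val_one, Int.cast_neg, Int.cast_one, neg_mul, one_mul, neg_neg]
  exact self_eq_neg.1 h

/-- The strictly increasing exponent `μ_{N - j} + j`. -/
def shiftedExp (μ : YoungDiagram) (N : ℕ) : Fin N →₀ ℕ :=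
  Finsupp.equivFunOnFinite.symm fun j => μ.rowLen (N - 1 - j) + j

theorem shiftedExp_apply (j : Fin N) : shiftedExp μ N j = μ.rowLen (N - 1 - j) + j := rfl

theorem shiftedExp_strictMono : StrictMono (shiftedExp μ N) := by
  intro i j hij
  rw [shiftedExp_apply, shiftedExp_apply]
  have := μ.rowLen_anti (N - 1 - j) (N - 1 - i) (by omega)
  have := Fin.lt_def.1 hij
  omega

variable (N T) in
/-- The product of the Vandermonde determinant and the characteristic polynomial. -/
def alternatingChar : MvPolynomial (Fin N) ℂ :=
  alternant (staircase N) * charPoly N (colSum T * rowSum T)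

theorem coeff_alternatingChar (β : Fin N →₀ ℕ) :
    (alternatingChar N T).coeff β = ∑ σ : Equiv.Perm (Fin N), ∑ f : Fin n → Fin N,
      if (staircase N).mapDomain σ + colorExp f = β then
        ((Equiv.Perm.sign σ : ℤ) : ℂ) * fixMult (colSum T * rowSum T) f else 0 := by
  classical
  rw [alternatingChar, alternant_eq, charPoly, Finset.sum_mul_sum, MvPolynomial.coeff_sum]
  refine Finset.sum_congr rfl fun σ _ => ?_
  rw [MvPolynomial.coeff_sum]
  refine Finset.sum_congr rfl fun f _ => ?_
  rw [MvPolynomial.monomial_mul, MvPolynomial.coeff_monomial]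

theorem sum_colorExp_layer_le {f : Fin n → Fin N} (hf : ColInjective T f) (β : Fin N → ℕ)
    (hβ : Monotone β) (t : ℕ) :
    ∑ j with t < β j, colorExp f j ≤ ∑ j with t < β j, μ.rowLen (N - 1 - j) := by
  rw [sum_rev_layer _ β hβ]
  refine le_trans (le_of_eq ?_) (hf.card_mem_le (Finset.univ.filter fun j => t < β j))
  simp only [colorExp_apply, colorCount]
  rw [Finset.card_eq_sum_card_fiberwise (f := f) (t := Finset.univ.filter fun j => t < β j)
    (fun u hu => by simpa using hu)]
  refine Finset.sum_congr rfl fun j hj => ?_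
  congr 1
  ext u
  simp only [Finset.mem_filter, Finset.mem_univ, true_and] at hj ⊢
  constructor
  · rintro rfl; exact ⟨hj, rfl⟩
  · exact fun h => h.2

theorem mapDomain_staircase_apply (σ : Equiv.Perm (Fin N)) (j : Fin N) :
    (staircase N).mapDomain σ j = (σ⁻¹ j : Fin N) := by
  conv_lhs => rw [← Equiv.apply_symm_apply σ j]
  rw [Finsupp.mapDomain_apply σ.injective, staircase_apply]
  rfl

/-- The operator `∑ (x_i ∂_i)^2` is diagonal on monomials with eigenvalue the sum of squared
exponents, so an eigenvector involves only one such value. The sandwich lemma and centrality of the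
transposition sum supply the scalar that `exists_casimir` needs. -/
theorem exists_sum_sq_eq (N : ℕ) (T : μ.Numbering n) :
    ∃ e : ℂ, ∀ β, (alternatingChar N T).coeff β ≠ 0 → ((∑ j, β j ^ 2 : ℕ) : ℂ) = e := by
  obtain ⟨c, hc⟩ := exists_rowSum_mul_mul_colSum T (transpositionSum n)
  obtain ⟨e, he⟩ := exists_casimir (N := N) (youngSymmetrizer T) c (by
    rw [← hc, youngSymmetrizer_eq, mul_assoc, mul_assoc, transpositionSum_central])
  refine ⟨e, fun β hβ => ?_⟩
  rw [youngSymmetrizer_eq, charPoly_mul_comm] at he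
  have h := congrArg (MvPolynomial.coeff β) he
  rw [MvPolynomial.coeff_C_mul, MvPolynomial.coeff_sum] at h
  simp only [coeff_euler, ← mul_assoc, ← Finset.sum_mul] at h
  have := mul_right_cancel₀ hβ h
  rw [← this]
  push_cast
  exact Finset.sum_congr rfl fun j _ => pow_two _

/-- A sorted exponent of the alternating character is dominated by the shifted partition. -/
theorem layers_of_coeff_ne_zero {β : Fin N →₀ ℕ} (hβ : Monotone β)
    (h : (alternatingChar N T).coeff β ≠ 0) :
    ∑ j, β j * β j ≤ ∑ j, β j * shiftedExp μ N j := by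
  rw [coeff_alternatingChar] at h
  obtain ⟨σ, -, h⟩ := Finset.exists_ne_zero_of_sum_ne_zero h
  obtain ⟨f, -, h⟩ := Finset.exists_ne_zero_of_sum_ne_zero h
  have hσf : (staircase N).mapDomain σ + colorExp f = β := by
    by_contra hne
    exact h (if_neg hne)
  have hf : ColInjective T f := by
    by_contra hne
    rw [fixMult_eq_zero hne] at h
    simp at h
  refine sum_mul_le_sum_mul_of_layers _ _ _ fun t => ?_
  have e : ∀ j, β j = (σ⁻¹ j : Fin N) + colorExp f j := fun j => by
    rw [← hσf, Finsupp.add_apply, mapDomain_staircase_apply]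
  have h1 := sum_perm_layer_le σ⁻¹ β hβ t
  have h2 := sum_colorExp_layer_le hf β hβ t
  have h3 : ∑ j with t < β j, β j =
      ∑ j with t < β j, ((σ⁻¹ j : Fin N) : ℕ) + ∑ j with t < β j, colorExp f j := by
    rw [← Finset.sum_add_distrib]
    exact Finset.sum_congr rfl fun j _ => e j
  simp only [shiftedExp_apply, Finset.sum_add_distrib]
  rw [h3]
  omega

/-- The exponent of the superstandard filling. -/
def partExp (μ : YoungDiagram) (N : ℕ) : Fin N →₀ ℕ :=
  Finsupp.equivFunOnFinite.symm fun j => μ.rowLen (N - 1 - j)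

/-- Only `σ = 1` survives: the layers of `colorExp f` are at most those of `μ`, so the layers of the
permuted staircase are at least those of the staircase. Having equal norms, the two staircases
coincide. -/
theorem coeff_shiftedExp :
    (alternatingChar N T).coeff (shiftedExp μ N) =
      ∑ f : Fin n → Fin N, if colorExp f = partExp μ N then
        fixMult (colSum T * rowSum T) f else 0 := by
  have hl : shiftedExp μ N = staircase N + partExp μ N := by
    ext j
    rw [Finsupp.add_apply, shiftedExp_apply, staircase_apply, add_comm]
    rfl
  rw [coeff_alternatingChar, Finset.sum_eq_single 1]
  · refine Finset.sum_congr rfl fun f _ => ?_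
    have : (staircase N).mapDomain (1 : Equiv.Perm (Fin N)) = staircase N := Finsupp.mapDomain_id
    rw [this, hl]
    simp
  · intro σ _ hσ
    refine Finset.sum_eq_zero fun f _ => ?_
    by_cases hf : ColInjective T f
    swap
    · rw [fixMult_eq_zero hf]; simp
    refine if_neg fun hσf => hσ ?_
    have e : ∀ j : Fin N, (j : ℕ) + μ.rowLen (N - 1 - j) = (σ⁻¹ j : Fin N) + colorExp f j :=
      fun j => by
        have := DFunLike.congr_fun hσf j
        rw [Finsupp.add_apply, mapDomain_staircase_apply, shiftedExp_apply] at this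
        omega
    have hle := sum_mul_le_sum_mul_of_layers (fun j : Fin N => (j : ℕ)) (fun j => (j : ℕ))
      (fun j => ((σ⁻¹ j : Fin N) : ℕ)) fun t => by
        have h2 := sum_colorExp_layer_le hf (fun j : Fin N => (j : ℕ)) (fun i j h => h) t
        have h3 := Finset.sum_congr (s₁ := Finset.univ.filter fun j : Fin N => t < (j : ℕ)) rfl
          fun j _ => e j
        rw [Finset.sum_add_distrib, Finset.sum_add_distrib] at h3
        omega
    have := eq_of_sum_sq_eq_of_le _ _ (Equiv.sum_comp σ⁻¹ fun j : Fin N => (j : ℕ) ^ 2).symm hle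
    have h1 : σ⁻¹ = 1 := Equiv.ext fun j => Fin.ext (congrFun this j).symm
    exact inv_eq_one.1 h1
  · simp

theorem colorExp_comp (τ : Equiv.Perm (Fin N)) (f : Fin n → Fin N) :
    colorExp (τ ∘ f) = (colorExp f).mapDomain τ := by
  simp only [colorExp, Finsupp.mapDomain_finsetSum, Finsupp.mapDomain_single, Function.comp_apply]

theorem rename_charPoly (τ : Equiv.Perm (Fin N)) (z : MonoidAlgebra ℂ (Equiv.Perm (Fin n))) :
    MvPolynomial.rename τ (charPoly N z) = charPoly N z := by
  rw [charPoly, map_sum]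
  refine Fintype.sum_equiv (Equiv.arrowCongr (Equiv.refl _) τ) _ _ fun f => ?_
  have h1 : Equiv.arrowCongr (Equiv.refl (Fin n)) τ f = τ ∘ f := rfl
  rw [h1, MvPolynomial.rename_monomial, colorExp_comp]
  congr 1
  simp only [fixMult, Function.comp_assoc, τ.injective.comp_left.eq_iff]

theorem rename_alternant (τ : Equiv.Perm (Fin N)) (L : Fin N →₀ ℕ) :
    MvPolynomial.rename τ (alternant L) =
      MvPolynomial.C ((Equiv.Perm.sign τ : ℤ) : ℂ) * alternant L := by
  rw [alternant_eq, map_sum, Finset.mul_sum]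
  refine Fintype.sum_equiv (Equiv.mulLeft τ) _ _ fun σ => ?_
  rw [MvPolynomial.rename_monomial, MvPolynomial.C_mul_monomial, Equiv.coe_mulLeft, map_mul Equiv.Perm.sign,
    Equiv.Perm.coe_mul, ← Finsupp.mapDomain_comp, Units.val_mul, Int.cast_mul, ← mul_assoc, ← Int.cast_mul,
    ← Units.val_mul, Int.units_mul_self]
  simp

theorem coeff_mapDomain_of_rename {p : MvPolynomial (Fin N) ℂ} {τ : Equiv.Perm (Fin N)}
    (h : MvPolynomial.rename τ p = MvPolynomial.C ((Equiv.Perm.sign τ : ℤ) : ℂ) * p)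
    (β : Fin N →₀ ℕ) :
    p.coeff β = ((Equiv.Perm.sign τ : ℤ) : ℂ) * p.coeff (β.mapDomain τ) := by
  rw [← MvPolynomial.coeff_rename_mapDomain τ τ.injective p β, h, MvPolynomial.coeff_C_mul]

/-- The Frobenius character formula, with an unspecified leading coefficient. -/
theorem alternatingChar_eq (h0 : (alternatingChar N T).coeff (shiftedExp μ N) ≠ 0) :
    alternatingChar N T =
      MvPolynomial.C ((alternatingChar N T).coeff (shiftedExp μ N)) *
        alternant (shiftedExp μ N) := by
  classical
  set c := (alternatingChar N T).coeff (shiftedExp μ N)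
  have hA : ∀ τ : Equiv.Perm (Fin N), MvPolynomial.rename τ (alternatingChar N T) =
      MvPolynomial.C ((Equiv.Perm.sign τ : ℤ) : ℂ) * alternatingChar N T := fun τ => by
    rw [alternatingChar, map_mul, rename_alternant, rename_charPoly, mul_assoc]
  have hB : ∀ τ : Equiv.Perm (Fin N), MvPolynomial.rename τ
      (MvPolynomial.C c * alternant (shiftedExp μ N)) =
      MvPolynomial.C ((Equiv.Perm.sign τ : ℤ) : ℂ) *
        (MvPolynomial.C c * alternant (shiftedExp μ N)) := fun τ => by
    rw [map_mul, rename_alternant, MvPolynomial.rename_C, mul_left_comm]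
  -- Strictly increasing exponents have no other sorted rearrangement, as the only order
  -- automorphism of `Fin N` is the identity.
  have hinj : ∀ σ : Equiv.Perm (Fin N), Monotone ((shiftedExp μ N).mapDomain σ) → σ = 1 := by
    intro σ hσ
    have h1 : StrictMono ⇑σ⁻¹ := by
      refine Monotone.strictMono_of_injective (fun i j hij => ?_) σ⁻¹.injective
      have := hσ hij
      rw [← Equiv.apply_symm_apply σ i, ← Equiv.apply_symm_apply σ j,
        Finsupp.mapDomain_apply σ.injective, Finsupp.mapDomain_apply σ.injective] at this
      simpa using shiftedExp_strictMono.le_iff_le.1 this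
    have h2 : (h1.orderIsoOfSurjective _ σ⁻¹.surjective) = OrderIso.refl (Fin N) :=
      Subsingleton.elim _ _
    have h3 : σ⁻¹ = 1 := Equiv.ext fun j => DFunLike.congr_fun h2 j
    exact inv_eq_one.1 h3
  obtain ⟨e, he⟩ := exists_sum_sq_eq N T
  have hsorted : ∀ β : Fin N →₀ ℕ, Monotone β → (alternatingChar N T).coeff β =
      (MvPolynomial.C c * alternant (shiftedExp μ N)).coeff β := by
    intro β hβ
    rw [MvPolynomial.coeff_C_mul, alternant_eq, MvPolynomial.coeff_sum]
    simp only [MvPolynomial.coeff_monomial]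
    by_cases hl : β = shiftedExp μ N
    · rw [Finset.sum_eq_single 1]
      · have : (shiftedExp μ N).mapDomain (1 : Equiv.Perm (Fin N)) = shiftedExp μ N :=
          Finsupp.mapDomain_id
        rw [this, if_pos hl.symm, hl]
        simp [c]
      · intro σ _ hσ
        exact if_neg fun h : (shiftedExp μ N).mapDomain σ = β => hσ (hinj σ (h ▸ hβ))
      · simp
    · rw [Finset.sum_eq_zero, mul_zero]
      · by_contra hne
        -- A sorted exponent that occurs is dominated by `shiftedExp` and has the same norm, the
        -- latter because `h0` makes `shiftedExp` itself occur.
        refine hl (DFunLike.coe_injective (eq_of_sum_sq_eq_of_le _ _ ?_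
          (layers_of_coeff_ne_zero hβ hne)))
        exact_mod_cast (he β hne).trans (he _ h0).symm
      · intro σ _
        refine if_neg fun h : (shiftedExp μ N).mapDomain σ = β => hl ?_
        have := hinj σ (h ▸ hβ)
        rw [← h, this]
        exact Finsupp.mapDomain_id
  ext β
  -- Both sides are alternating, so sorting `β` changes both coefficients by the same sign.
  have hmono : Monotone (β.mapDomain ⇑(Tuple.sort β)⁻¹) := by
    have h1 := Tuple.monotone_sort β
    have h2 : ⇑(β.mapDomain ⇑(Tuple.sort β)⁻¹) = β ∘ Tuple.sort β := by
      funext j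
      conv_lhs => rw [← Equiv.symm_apply_apply (Tuple.sort β) j]
      exact Finsupp.mapDomain_apply (Tuple.sort β)⁻¹.injective _ _
    rw [h2]
    exact h1
  rw [coeff_mapDomain_of_rename (hA (Tuple.sort β)⁻¹), coeff_mapDomain_of_rename (hB _),
    hsorted _ hmono]

end YoungDiagram

/-! ### The leading coefficient -/

namespace YoungDiagram

open TensorSpace

variable {μ : YoungDiagram} {n N : ℕ} {T : μ.Numbering n}

theorem coeff_rowSum_mul_mul_colSum (w : MonoidAlgebra ℂ (Equiv.Perm (Fin n))) :
    (rowSum T * (w * colSum T)).coeff 1 =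
      ∑ q : Equiv.Perm (Fin n), ∑ p : Equiv.Perm (Fin n), open Classical in
        if ColStab T q ∧ RowStab T p then
          ((Equiv.Perm.sign q : ℤ) : ℂ) * w.coeff (p * q) else 0 := by
  classical
  rw [rowSum, colSum, Finset.mul_sum, Finset.sum_mul_sum, Finset.sum_comm, Finset.sum_filter,
    MonoidAlgebra.coeff_sum, Finsupp.finsetSum_apply]
  refine Fintype.sum_equiv (Equiv.inv _) _ _ fun q => ?_
  have hq : ColStab T q⁻¹ ↔ ColStab T q := ⟨fun h => by simpa using h.inv, ColStab.inv⟩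
  by_cases h : ColStab T q
  · rw [if_pos h, Finset.sum_filter, MonoidAlgebra.coeff_sum, Finsupp.finsetSum_apply]
    refine Fintype.sum_equiv (Equiv.inv _) _ _ fun p => ?_
    have hp : RowStab T p⁻¹ ↔ RowStab T p := ⟨fun h => by simpa using h.inv, RowStab.inv⟩
    by_cases h' : RowStab T p
    · simp only [Equiv.inv_apply, hq, hp, h, h', and_self, if_true, mul_smul_comm,
        MonoidAlgebra.coeff_smul_apply, MonoidAlgebra.of_apply,
        MonoidAlgebra.coeff_single_mul_apply, MonoidAlgebra.coeff_mul_single_apply,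
        Equiv.Perm.sign_inv, one_mul, mul_one, smul_eq_mul]
    · simp [h', hp]
  · simp [h, hq]

/-- Compare the coefficients of the identity in `e^2 = c e`, where that of `e` is `1`. The double
sum has the shape in which the leading coefficient will appear. -/
theorem symmetrizerScalar_eq (T : μ.Numbering n) :
    symmetrizerScalar T = ∑ q : Equiv.Perm (Fin n), ∑ p : Equiv.Perm (Fin n),
      open Classical in if ColStab T q ∧ RowStab T p then
        ((Equiv.Perm.sign q : ℤ) : ℂ) * (colSum T * rowSum T).coeff (p * q) else 0 := by
  rw [← coeff_rowSum_mul_mul_colSum]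
  have h := congrArg (fun z => z.coeff 1) (youngSymmetrizer_sq T)
  simp only [MonoidAlgebra.coeff_smul_apply, coeff_one_youngSymmetrizer, smul_eq_mul,
    mul_one] at h
  rw [← h, youngSymmetrizer_eq]
  simp only [mul_assoc]

theorem row_lt_colLen (T : μ.Numbering n) (u : Fin n) : (T u).1.1 < μ.colLen 0 :=
  mem_iff_lt_colLen.1 (μ.up_left_mem le_rfl (Nat.zero_le _) (T u).2)

/-- The superstandard filling, with the rows numbered from the bottom. -/
def superstandard (T : μ.Numbering n) (hN : μ.colLen 0 ≤ N) (u : Fin n) : Fin N :=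
  ⟨N - 1 - (T u).1.1, by have := row_lt_colLen T u; omega⟩

theorem superstandard_eq_iff (hN : μ.colLen 0 ≤ N) {u v : Fin n} :
    superstandard T hN u = superstandard T hN v ↔ (T u).1.1 = (T v).1.1 := by
  have := row_lt_colLen T u
  have := row_lt_colLen T v
  rw [superstandard, superstandard, Fin.mk.injEq]
  omega

theorem colorExp_superstandard_comp (hN : μ.colLen 0 ≤ N) (q : Equiv.Perm (Fin n)) :
    colorExp (superstandard T hN ∘ q) = partExp μ N := by
  have h : colorExp (superstandard T hN ∘ q) = colorExp (superstandard T hN) :=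
    Equiv.sum_comp q fun u => Finsupp.single (superstandard T hN u) 1
  rw [h]
  ext j
  rw [colorExp_apply, colorCount]
  show _ = μ.rowLen (N - 1 - j)
  rw [← card_row_eq T]
  congr 1
  ext u
  have := row_lt_colLen T u
  have := j.2
  simp only [Finset.mem_filter, Finset.mem_univ, true_and, superstandard, Fin.ext_iff]
  omega

theorem ColInjective.exists_superstandard {f : Fin n → Fin N} (hf : ColInjective T f)
    (hN : μ.colLen 0 ≤ N) (hc : colorExp f = partExp μ N) :
    ∃ q : Equiv.Perm (Fin n), ColStab T q ∧ superstandard T hN ∘ q = f := by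
  have hf' : ColInjective T (fun u => N - 1 - (f u : ℕ)) := fun u v huv h => by
    refine hf u v huv (Fin.ext ?_)
    have := (f u).2
    have := (f v).2
    simp only at h
    omega
  obtain ⟨q, hq1, hq2⟩ := hf'.exists_perm fun k => by
    by_cases hk : k < N
    · have h1 := DFunLike.congr_fun hc ⟨N - 1 - k, by omega⟩
      rw [colorExp_apply, colorCount] at h1
      have h2 : partExp μ N ⟨N - 1 - k, by omega⟩ = μ.rowLen k := by
        show μ.rowLen (N - 1 - (N - 1 - k)) = _
        congr 1
        omega
      rw [← h2, ← h1]
      congr 1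
      ext u
      have := (f u).2
      simp only [Finset.mem_filter, Finset.mem_univ, true_and, Fin.ext_iff]
      omega
    · have h1 : μ.rowLen k = 0 := by
        by_contra h
        have h2 : (k, 0) ∈ μ := mem_iff_lt_rowLen.2 (Nat.pos_of_ne_zero h)
        have := mem_iff_lt_colLen.1 h2
        omega
      rw [h1, Finset.card_eq_zero, Finset.filter_eq_empty_iff]
      intro u _
      have := (f u).2
      omega
  refine ⟨q, hq1, funext fun u => Fin.ext ?_⟩
  have := (f u).2
  simp only [Function.comp_apply, superstandard, hq2]
  omega

/-- The stabilizer of the translated filling is the row stabilizer conjugated by `q`. The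
substitution `p = q g q⁻¹` gives `p q = q g`, and antisymmetry on the left yields the sign. -/
theorem fixMult_superstandard_comp (hN : μ.colLen 0 ≤ N) {q : Equiv.Perm (Fin n)}
    (hq : ColStab T q) :
    fixMult (colSum T * rowSum T) (superstandard T hN ∘ q) =
      ∑ p : Equiv.Perm (Fin n), open Classical in if RowStab T p then
        ((Equiv.Perm.sign q : ℤ) : ℂ) * (colSum T * rowSum T).coeff (p * q) else 0 := by
  classical
  rw [fixMult]
  refine Fintype.sum_equiv (MulAut.conj q).toEquiv _ _ fun g => ?_
  have h1 : (superstandard T hN ∘ q) ∘ g = superstandard T hN ∘ q ↔ RowStab T (q * g * q⁻¹) := by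
    rw [funext_iff]
    simp only [Function.comp_apply, superstandard_eq_iff]
    constructor
    · intro h x
      have := h (q⁻¹ x)
      simpa using this
    · intro h x
      have := h (q x)
      simpa using this
  have h2 : (colSum T * rowSum T).coeff g =
      ((Equiv.Perm.sign q : ℤ) : ℂ) * (colSum T * rowSum T).coeff (q * g) := by
    rw [← coeff_colSum_mul hq]
    simp
  have h3 : (MulAut.conj q).toEquiv g = q * g * q⁻¹ := rfl
  rw [h3]
  by_cases h : RowStab T (q * g * q⁻¹)
  · rw [if_pos h, if_pos (h1.2 h), h2]
    simp
  · rw [if_neg h, if_neg (fun h' => h (h1.1 h')), mul_zero]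

/-- The leading coefficient of the alternating character. -/
theorem coeff_shiftedExp_eq (T : μ.Numbering n) (hN : μ.colLen 0 ≤ N) :
    (alternatingChar N T).coeff (shiftedExp μ N) = symmetrizerScalar T := by
  classical
  -- Only column-injective fillings contribute, and those with this exponent correspond bijectively
  -- to column permutations of the superstandard one.
  have h1 : ∑ f : Fin n → Fin N, (if colorExp f = partExp μ N then
      fixMult (colSum T * rowSum T) f else 0) =
      ∑ f : Fin n → Fin N with ColInjective T f ∧ colorExp f = partExp μ N,
        fixMult (colSum T * rowSum T) f := by
    rw [Finset.sum_filter]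
    refine Finset.sum_congr rfl fun f _ => ?_
    by_cases hf : ColInjective T f
    · simp [hf]
    · simp [hf, fixMult_eq_zero hf]
  have h2 : ∑ f : Fin n → Fin N with ColInjective T f ∧ colorExp f = partExp μ N,
        fixMult (colSum T * rowSum T) f =
      ∑ q : Equiv.Perm (Fin n) with ColStab T q,
        fixMult (colSum T * rowSum T) (superstandard T hN ∘ q) := by
    symm
    refine Finset.sum_bij (fun q _ => superstandard T hN ∘ q) ?_ ?_ ?_ (fun _ _ => rfl)
    · intro q hq
      have hq := (Finset.mem_filter.1 hq).2
      rw [Finset.mem_filter]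
      refine ⟨Finset.mem_univ _, fun u v huv h => ?_, colorExp_superstandard_comp hN q⟩
      have h := (superstandard_eq_iff hN).1 h
      exact q.injective (T.injective (Subtype.ext (Prod.ext h
        ((hq u).trans (huv.trans (hq v).symm)))))
    · intro q hq q' hq' h
      have hq := (Finset.mem_filter.1 hq).2
      have hq' := (Finset.mem_filter.1 hq').2
      refine Equiv.ext fun u => T.injective (Subtype.ext (Prod.ext ?_ ((hq u).trans (hq' u).symm)))
      exact (superstandard_eq_iff hN).1 (congrFun h u)
    · intro f hf
      obtain ⟨-, h1, h2⟩ := Finset.mem_filter.1 hf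
      obtain ⟨q, hq, rfl⟩ := h1.exists_superstandard hN h2
      exact ⟨q, by simpa using hq, rfl⟩
  rw [coeff_shiftedExp, h1, h2, symmetrizerScalar_eq, Finset.sum_filter]
  refine Finset.sum_congr rfl fun q _ => ?_
  by_cases hq : ColStab T q
  · simp [hq, fixMult_superstandard_comp hN hq]
  · simp [hq]

/-- The Frobenius character formula. -/
theorem alternant_mul_charPoly (T : μ.Numbering n) (hN : μ.colLen 0 ≤ N) :
    alternant (staircase N) * charPoly N (youngSymmetrizer T) =
      MvPolynomial.C (symmetrizerScalar T) * alternant (shiftedExp μ N) := by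
  have h := coeff_shiftedExp_eq T hN
  rw [← h, youngSymmetrizer_eq, charPoly_mul_comm]
  exact alternatingChar_eq (h ▸ symmetrizerScalar_ne_zero T)

/-! ### Hook lengths, contents and the principal specialization -/

section Hooks

variable {K : Type} [Field K]

theorem lt_rowLen_iff_lt_colLen {i j : ℕ} : j < μ.rowLen i ↔ i < μ.colLen j := by
  rw [← mem_iff_lt_rowLen, mem_iff_lt_colLen]

/-- The numbers `1, …, m` with `m = μ_r + N - 1 - r` are the hook lengths of the boxes in row `r`
together with the differences of the shifted parts. -/
theorem prod_hooks_row (μ : YoungDiagram) {N r : ℕ} (hN : μ.colLen 0 ≤ N) (hr : r < N)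
    (F : ℕ → K) :
    (∏ s ∈ Finset.Ioo r N, F ((μ.rowLen r + (N - 1 - r)) - (μ.rowLen s + (N - 1 - s)))) *
      ∏ c ∈ Finset.range (μ.rowLen r), F (μ.hookLength (r, c)) =
    ∏ k ∈ Finset.Ico 1 (N - r + μ.rowLen r), F k := by
  have hcol : ∀ c, μ.colLen c ≤ N := fun c => (μ.colLen_anti 0 c (Nat.zero_le _)).trans hN
  let d : ℕ → ℕ := fun s => (μ.rowLen r + (N - 1 - r)) - (μ.rowLen s + (N - 1 - s))
  let h : ℕ → ℕ := fun c => μ.hookLength (r, c)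
  have hh : ∀ c, c < μ.rowLen r →
      h c + (c + 1) + r = μ.rowLen r + μ.colLen c ∧ r < μ.colLen c := fun c hc => by
    have h1 := lt_rowLen_iff_lt_colLen.1 hc
    refine ⟨?_, h1⟩
    simp only [h, hookLength]
    omega
  have hd : ∀ s ∈ Finset.Ioo r N, d s + μ.rowLen s + r = μ.rowLen r + s ∧ r < s ∧ s < N ∧
      μ.rowLen s ≤ μ.rowLen r := fun s hs => by
    obtain ⟨h1, h2⟩ := Finset.mem_Ioo.1 hs
    have := μ.rowLen_anti r s h1.le
    simp only [d]
    omega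
  have hdinj : Set.InjOn d (Finset.Ioo r N) := by
    intro s hs s' hs' he
    have h1 := hd s hs
    have h2 := hd s' hs'
    by_contra hne
    rcases Nat.lt_or_gt_of_ne hne with hlt | hlt
    · have := μ.rowLen_anti s s' hlt.le
      omega
    · have := μ.rowLen_anti s' s hlt.le
      omega
  have hhinj : Set.InjOn h (Finset.range (μ.rowLen r)) := by
    intro c hc c' hc' he
    have h1 := hh c (Finset.mem_range.1 hc)
    have h2 := hh c' (Finset.mem_range.1 hc')
    by_contra hne
    rcases Nat.lt_or_gt_of_ne hne with hlt | hlt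
    · have := μ.colLen_anti c c' hlt.le
      omega
    · have := μ.colLen_anti c' c hlt.le
      omega
  -- A common value would mean `s + c + 1 = μ_s + μ'_c`, with `μ'_c` the length of column `c`. The
  -- right side is at least `s + c + 2` if `(s, c)` is a box and at most `s + c` otherwise.
  have hdisj : Disjoint ((Finset.Ioo r N).image d) ((Finset.range (μ.rowLen r)).image h) := by
    rw [Finset.disjoint_left]
    intro k hk hk'
    obtain ⟨s, hs, rfl⟩ := Finset.mem_image.1 hk
    obtain ⟨c, hc, he⟩ := Finset.mem_image.1 hk'
    have h1 := hd s hs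
    have h2 := hh c (Finset.mem_range.1 hc)
    have h3 := lt_rowLen_iff_lt_colLen (μ := μ) (i := s) (j := c)
    omega
  have hunion : (Finset.Ioo r N).image d ∪ (Finset.range (μ.rowLen r)).image h =
      Finset.Ico 1 (N - r + μ.rowLen r) := by
    refine Finset.eq_of_subset_of_card_le ?_ ?_
    · intro k hk
      rw [Finset.mem_Ico]
      rcases Finset.mem_union.1 hk with hk | hk
      · obtain ⟨s, hs, rfl⟩ := Finset.mem_image.1 hk
        have h1 := hd s hs
        omega
      · obtain ⟨c, hc, rfl⟩ := Finset.mem_image.1 hk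
        have h2 := hh c (Finset.mem_range.1 hc)
        have := hcol c
        have : 1 ≤ h c := Nat.le_add_left 1 _
        omega
    · rw [Finset.card_union_of_disjoint hdisj, Finset.card_image_of_injOn hdinj,
        Finset.card_image_of_injOn hhinj]
      simp only [Nat.card_Ico, Nat.card_Ioo, Finset.card_range]
      omega
  rw [← hunion, Finset.prod_union hdisj, Finset.prod_image hdinj, Finset.prod_image hhinj]

/-- The interval splits at `N - r`. The right side is that of `prod_hooks_row`, which is how hooks
are exchanged for contents one row at a time. -/
theorem prod_contents_row (μ : YoungDiagram) {N r : ℕ} (hr : r < N) (F : ℕ → K) :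
    (∏ s ∈ Finset.Ioo r N, F (s - r)) *
      ∏ c ∈ Finset.range (μ.rowLen r), F (N + c - r) =
    ∏ k ∈ Finset.Ico 1 (N - r + μ.rowLen r), F k := by
  rw [← Finset.prod_Ico_consecutive F (show 1 ≤ N - r by omega) (Nat.le_add_right _ _)]
  congr 1
  · refine Finset.prod_bij' (fun s _ => s - r) (fun k _ => k + r) ?_ ?_ ?_ ?_ ?_ <;>
      simp only [Finset.mem_Ioo, Finset.mem_Ico] <;> intros <;> first | omega | trivial
  · refine Finset.prod_bij' (fun c _ => N + c - r) (fun k _ => k + r - N) ?_ ?_ ?_ ?_ ?_ <;>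
      simp only [Finset.mem_range, Finset.mem_Ico] <;> intros <;> first | omega | trivial

theorem prod_cells (μ : YoungDiagram) {N : ℕ} (hN : μ.colLen 0 ≤ N) (G : ℕ × ℕ → K) :
    ∏ c ∈ μ.cells, G c = ∏ r ∈ Finset.range N, ∏ c ∈ Finset.range (μ.rowLen r), G (r, c) := by
  rw [Finset.prod_sigma']
  refine Finset.prod_bij' (fun c _ => ⟨c.1, c.2⟩) (fun x _ => (x.1, x.2)) ?_ ?_ ?_ ?_ ?_
  · rintro ⟨i, j⟩ h
    have h := (mem_cells _).1 h
    have h1 := mem_iff_lt_colLen.1 h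
    have := μ.colLen_anti 0 j (Nat.zero_le _)
    simp only [Finset.mem_sigma, Finset.mem_range]
    exact ⟨by omega, mem_iff_lt_rowLen.1 h⟩
  · rintro ⟨i, j⟩ h
    simp only [Finset.mem_sigma, Finset.mem_range] at h
    exact (mem_cells _).2 (mem_iff_lt_rowLen.2 h.2)
  · simp
  · simp
  · simp

theorem nStat_eq (μ : YoungDiagram) {N : ℕ} (hN : μ.colLen 0 ≤ N) :
    μ.nStat = ∑ i ∈ Finset.range N, i * μ.rowLen i := by
  refine Finset.sum_subset (Finset.range_subset_range.2 hN) fun i _ hi => ?_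
  have : μ.rowLen i = 0 := by
    by_contra h
    exact hi (Finset.mem_range.2 (lt_rowLen_iff_lt_colLen.1 (Nat.pos_of_ne_zero h)))
  rw [this, mul_zero]

theorem prod_pairs_eq (N : ℕ) (F : ℕ → ℕ → K) :
    ∏ p ∈ pairs N, F (N - 1 - p.2) (N - 1 - p.1) =
      ∏ r ∈ Finset.range N, ∏ s ∈ Finset.Ioo r N, F r s := by
  rw [Finset.prod_sigma']
  refine Finset.prod_bij (fun p _ => ⟨N - 1 - p.2, N - 1 - p.1⟩) ?_ ?_ ?_ ?_
  · rintro ⟨i, j⟩ h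
    have := Fin.lt_def.1 (Finset.mem_filter.1 h).2
    have := i.2
    have := j.2
    simp only [Finset.mem_sigma, Finset.mem_range, Finset.mem_Ioo] at *
    omega
  · rintro ⟨i, j⟩ _ ⟨i', j'⟩ _ h
    simp only [Sigma.mk.injEq, heq_eq_eq] at h
    ext
    · simp only; omega
    · simp only; omega
  · rintro ⟨r, s⟩ h
    simp only [Finset.mem_sigma, Finset.mem_range, Finset.mem_Ioo] at h
    refine ⟨(⟨N - 1 - s, by omega⟩, ⟨N - 1 - r, by omega⟩), ?_, ?_⟩
    · simp only [pairs, Finset.mem_filter, Finset.mem_univ, true_and, Fin.lt_def]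
      omega
    · simp only [Sigma.mk.injEq, heq_eq_eq]
      omega
  · intros; rfl

/-- Row `s` occurs once for each `r < s`, that is, `s` times. -/
theorem prod_pow_nStat (μ : YoungDiagram) {N : ℕ} (hN : μ.colLen 0 ≤ N) (Q : K) :
    ∏ r ∈ Finset.range N, ∏ s ∈ Finset.Ioo r N, Q ^ μ.rowLen s = Q ^ μ.nStat := by
  rw [nStat_eq μ hN, ← Finset.prod_pow_eq_pow_sum, Finset.prod_sigma',
    ← Finset.prod_fiberwise_of_maps_to (t := Finset.range N) (g := fun x => x.2)]
  · refine Finset.prod_congr rfl fun s hs => ?_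
    have e : (Q ^ μ.rowLen s) ^ s = ∏ _r ∈ Finset.range s, Q ^ μ.rowLen s := by simp
    rw [mul_comm, pow_mul, e]
    refine Finset.prod_bij' (fun x _ => x.1) (fun r _ => ⟨r, s⟩) ?_ ?_ ?_ ?_ ?_
    · rintro ⟨r, s'⟩ h
      simp only [Finset.mem_filter, Finset.mem_sigma, Finset.mem_range, Finset.mem_Ioo] at h ⊢
      omega
    · intro r h
      simp only [Finset.mem_filter, Finset.mem_sigma, Finset.mem_range, Finset.mem_Ioo] at h hs ⊢
      refine ⟨?_, ?_⟩ <;> first | omega | trivial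
    · rintro ⟨r, s'⟩ h
      simp only [Finset.mem_filter] at h
      rw [h.2]
    · intros; rfl
    · rintro ⟨r, s'⟩ h
      simp only [Finset.mem_filter] at h
      simp [h.2]
  · rintro ⟨r, s⟩ h
    simp only [Finset.mem_sigma, Finset.mem_range, Finset.mem_Ioo] at h ⊢
    omega

/-- The principal specialization of the bialternant formula, in terms of hooks and contents. -/
theorem prod_shifted_mul_prod_hooks (μ : YoungDiagram) {N : ℕ} (hN : μ.colLen 0 ≤ N) (Q : K) :
    (∏ p ∈ pairs N, (Q ^ shiftedExp μ N p.2 - Q ^ shiftedExp μ N p.1)) *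
      ∏ c ∈ μ.cells, (1 - Q ^ μ.hookLength c) =
    Q ^ μ.nStat * (∏ p ∈ pairs N, (Q ^ staircase N p.2 - Q ^ staircase N p.1)) *
      ∏ c ∈ μ.cells, (1 - Q ^ (N + c.2 - c.1)) := by
  have e1 := prod_pairs_eq N fun r s =>
    Q ^ (μ.rowLen r + (N - 1 - r)) - Q ^ (μ.rowLen s + (N - 1 - s))
  have e2 := prod_pairs_eq N fun r s => Q ^ (N - 1 - r) - Q ^ (N - 1 - s)
  have hsub : ∀ i : Fin N, N - 1 - (N - 1 - (i : ℕ)) = i := fun i => by omega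
  simp only [hsub] at e1 e2
  simp only [shiftedExp_apply, staircase_apply]
  rw [e1, e2, prod_cells μ hN, prod_cells μ hN, ← prod_pow_nStat μ hN Q]
  simp only [← Finset.prod_mul_distrib]
  refine Finset.prod_congr rfl fun r hr => ?_
  have hr := Finset.mem_range.1 hr
  have h1 := prod_hooks_row μ hN hr fun k => 1 - Q ^ k
  have h2 := prod_contents_row μ hr fun k => 1 - Q ^ k
  -- In each factor of the two Vandermonde products the lower power of `Q` is extracted. Those
  -- powers differ only by `Q ^ μ.rowLen s`, which accumulates to `Q ^ μ.nStat`.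
  have e3 : ∏ s ∈ Finset.Ioo r N, (Q ^ (μ.rowLen r + (N - 1 - r)) -
      Q ^ (μ.rowLen s + (N - 1 - s))) =
      (∏ s ∈ Finset.Ioo r N, Q ^ μ.rowLen s) * (∏ s ∈ Finset.Ioo r N, - Q ^ (N - 1 - s)) *
      ∏ s ∈ Finset.Ioo r N,
        (1 - Q ^ ((μ.rowLen r + (N - 1 - r)) - (μ.rowLen s + (N - 1 - s)))) := by
    rw [← Finset.prod_mul_distrib, ← Finset.prod_mul_distrib]
    refine Finset.prod_congr rfl fun s hs => ?_
    obtain ⟨h3, h4⟩ := Finset.mem_Ioo.1 hs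
    have := μ.rowLen_anti r s h3.le
    have e : μ.rowLen r + (N - 1 - r) = μ.rowLen s + (N - 1 - s) +
      ((μ.rowLen r + (N - 1 - r)) - (μ.rowLen s + (N - 1 - s))) := by omega
    conv_lhs => rw [e]
    rw [pow_add, pow_add]
    ring
  have e4 : ∏ s ∈ Finset.Ioo r N, Q ^ μ.rowLen s * (Q ^ (N - 1 - r) - Q ^ (N - 1 - s)) =
      (∏ s ∈ Finset.Ioo r N, Q ^ μ.rowLen s) * (∏ s ∈ Finset.Ioo r N, - Q ^ (N - 1 - s)) *
      ∏ s ∈ Finset.Ioo r N, (1 - Q ^ (s - r)) := by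
    rw [← Finset.prod_mul_distrib, ← Finset.prod_mul_distrib]
    refine Finset.prod_congr rfl fun s hs => ?_
    obtain ⟨h3, h4⟩ := Finset.mem_Ioo.1 hs
    have e : N - 1 - r = N - 1 - s + (s - r) := by omega
    rw [e, pow_add]
    ring
  rw [e3, e4, mul_assoc, h1, ← h2]
  ring

end Hooks

end YoungDiagram

/-! ### Invariance of cycle products under conjugation and inversion -/

section CycleProducts

variable {α : Type} [Fintype α]

theorem prod_cycleLen_congr {K : Type} [CommMonoid K] (g g' : Equiv.Perm α) (e : Equiv.Perm α)
    (h : ∀ i j, g.SameCycle i j ↔ g'.SameCycle (e i) (e j)) (F : ℕ → K) :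
    ∏ c : CycleClass g, F (cycleLen g c) = ∏ c : CycleClass g', F (cycleLen g' c) := by
  classical
  let E : CycleClass g ≃ CycleClass g' := Quotient.congr e h
  have hE : ∀ i, E (cycleClass g i) = cycleClass g' (e i) := fun i => rfl
  refine Fintype.prod_equiv E _ _ fun c => ?_
  congr 1
  rw [cycleLen, cycleLen]
  refine Finset.card_bij (fun i _ => e i) ?_ (fun i _ j _ hij => e.injective hij) ?_
  · intro i hi
    have := (Finset.mem_filter.1 hi).2
    simp [← this, hE]
  · intro j hj
    refine ⟨e.symm j, ?_, by simp⟩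
    have h1 := (Finset.mem_filter.1 hj).2
    have h2 := hE (e.symm j)
    rw [Equiv.apply_symm_apply, h1] at h2
    simpa using E.injective h2

theorem prod_cycleLen_conj {K : Type} [CommMonoid K] (g h : Equiv.Perm α) (F : ℕ → K) :
    ∏ c : CycleClass (h * g * h⁻¹), F (cycleLen _ c) = ∏ c : CycleClass g, F (cycleLen g c) := by
  refine (prod_cycleLen_congr g (h * g * h⁻¹) h (fun i j => ?_) F).symm
  rw [Equiv.Perm.sameCycle_conj]
  simp

theorem prod_cycleLen_inv {K : Type} [CommMonoid K] (g : Equiv.Perm α) (F : ℕ → K) :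
    ∏ c : CycleClass g⁻¹, F (cycleLen _ c) = ∏ c : CycleClass g, F (cycleLen g c) :=
  prod_cycleLen_congr g⁻¹ g 1 (fun _ _ => Equiv.Perm.sameCycle_inv) F

end CycleProducts

/-! ### Specializations of the Specht character -/

namespace YoungDiagram

open TensorSpace

variable {μ : YoungDiagram} {n N : ℕ} {K : Type} [Field K] [Algebra ℂ K]

theorem aeval_charPoly (x : Fin N → K) (z : MonoidAlgebra ℂ (Equiv.Perm (Fin n))) :
    MvPolynomial.aeval x (charPoly N z) =
      ∑ g, algebraMap ℂ K (z.coeff g) *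
        ∏ c : CycleClass g, ∑ i, x i ^ cycleLen g c := by
  simp only [← sum_invariant_prod, Finset.mul_sum, charPoly, map_sum]
  rw [Finset.sum_comm]
  refine Finset.sum_congr rfl fun f _ => ?_
  have h1 : MvPolynomial.monomial (colorExp f) (fixMult z f) =
      MvPolynomial.C (fixMult z f) * colorMonomial f := by
    rw [colorMonomial_eq, MvPolynomial.C_mul_monomial, mul_one]
  rw [h1, map_mul, MvPolynomial.algHom_C, colorMonomial, map_prod, fixMult, map_sum,
    Finset.sum_mul]
  refine Finset.sum_congr rfl fun g _ => ?_
  simp only [MvPolynomial.aeval_X]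
  split_ifs <;> simp

/-- At `x_i = Q^i` the entries become `(Q^(L j))^i`, a transposed Vandermonde matrix in the nodes
`Q^(L j)`. -/
theorem aeval_alternant (Q : K) (L : Fin N →₀ ℕ) :
    MvPolynomial.aeval (fun i : Fin N => Q ^ (i : ℕ)) (alternant L) =
      ∏ p ∈ pairs N, (Q ^ L p.2 - Q ^ L p.1) := by
  have h1 : MvPolynomial.aeval (fun i : Fin N => Q ^ (i : ℕ)) (alternant L) =
      (Matrix.vandermonde fun j => Q ^ L j).det := by
    rw [alternant, AlgHom.map_det, ← Matrix.det_transpose]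
    congr 1
    ext i j
    simp [Matrix.vandermonde_apply, ← pow_mul, mul_comm]
  rw [h1, Matrix.det_vandermonde, pairs, Finset.prod_filter, Fintype.prod_prod_type]
  refine Finset.prod_congr rfl fun i _ => ?_
  rw [← Finset.prod_filter]
  congr 1
  ext j
  simp

/-- The principal specialization of the character of a Specht module. -/
theorem principal_specialization (T : μ.Numbering n) (hN : μ.colLen 0 ≤ N) {Q : K} (hQ0 : Q ≠ 0)
    (hQ : ∀ k, k ≠ 0 → Q ^ k ≠ 1) :
    (∑ g, algebraMap ℂ K ((youngSymmetrizer T).coeff g) *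
      ∏ c : CycleClass g, (1 - (Q ^ N) ^ cycleLen g c) / (1 - Q ^ cycleLen g c)) =
    algebraMap ℂ K (symmetrizerScalar T) * Q ^ μ.nStat *
      ∏ c ∈ μ.cells, (1 - Q ^ N * Q ^ content c) / (1 - Q ^ μ.hookLength c) := by
  have h := congrArg (MvPolynomial.aeval (fun i : Fin N => Q ^ (i : ℕ)))
    (alternant_mul_charPoly T hN)
  rw [map_mul, map_mul, aeval_alternant, aeval_alternant, MvPolynomial.algHom_C,
    aeval_charPoly] at h
  have h1 : ∀ k, k ≠ 0 → ∑ i : Fin N, (Q ^ (i : ℕ)) ^ k = (1 - (Q ^ N) ^ k) / (1 - Q ^ k) := by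
    intro k hk
    have hne : Q ^ k ≠ 1 := hQ k hk
    rw [Fin.sum_univ_eq_sum_range (fun i => (Q ^ i) ^ k)]
    simp only [← pow_mul, mul_comm _ k]
    simp only [pow_mul]
    rw [geom_sum_eq hne, ← neg_div_neg_eq, neg_sub, neg_sub]
  have h2 : ∀ g : Equiv.Perm (Fin n), ∏ c : CycleClass g, ∑ i : Fin N, (Q ^ (i : ℕ)) ^ cycleLen g c =
      ∏ c : CycleClass g, (1 - (Q ^ N) ^ cycleLen g c) / (1 - Q ^ cycleLen g c) := fun g =>
    Finset.prod_congr rfl fun c _ => h1 _ (cycleLen_pos g c).ne'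
  simp only [h2] at h
  have h3 := prod_shifted_mul_prod_hooks μ hN Q
  -- Since `Q` is nonzero and not a root of unity, its powers are distinct and the Vandermonde
  -- determinant can be cancelled.
  have hV : ∏ p ∈ pairs N, (Q ^ staircase N p.2 - Q ^ staircase N p.1) ≠ 0 := by
    refine Finset.prod_ne_zero_iff.2 fun p hp => ?_
    have hlt := Fin.lt_def.1 (Finset.mem_filter.1 hp).2
    rw [staircase_apply, staircase_apply, sub_ne_zero]
    intro he
    have : (p.2 : ℕ) = p.1 + (p.2 - p.1) := by omega
    rw [this, pow_add] at he
    exact hQ (p.2 - p.1) (by omega) (mul_left_cancel₀ (pow_ne_zero _ hQ0) (he.trans (mul_one _).symm))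
  have hH : ∏ c ∈ μ.cells, (1 - Q ^ μ.hookLength c) ≠ 0 :=
    Finset.prod_ne_zero_iff.2 fun c _ => sub_ne_zero.2 (hQ _ (Nat.succ_ne_zero _)).symm
  have h4 : ∏ c ∈ μ.cells, (1 - Q ^ N * Q ^ content c) =
      ∏ c ∈ μ.cells, (1 - Q ^ (N + c.2 - c.1)) := by
    refine Finset.prod_congr rfl fun c hc => ?_
    have h5 := mem_iff_lt_colLen.1 ((mem_cells _).1 hc)
    have h6 := μ.colLen_anti 0 c.2 (Nat.zero_le _)
    rw [← zpow_natCast, ← zpow_natCast, ← zpow_add₀ hQ0, content]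
    congr 3
    omega
  rw [Finset.prod_div_distrib, h4, mul_div_assoc', eq_div_iff hH]
  refine mul_left_cancel₀ hV ?_
  linear_combination (∏ c ∈ μ.cells, (1 - Q ^ μ.hookLength c)) * h +
    algebraMap ℂ K (symmetrizerScalar T) * h3

/-- The specialization `p_k ↦ (1 - a ^ k) / (1 - Q ^ k)` of the character of a Specht module. -/
theorem specialization (T : μ.Numbering n) {Q : K} (hQ0 : Q ≠ 0)
    (hQ : ∀ k, k ≠ 0 → Q ^ k ≠ 1) (a : K) :
    (∑ g, algebraMap ℂ K ((youngSymmetrizer T).coeff g) *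
      ∏ c : CycleClass g, (1 - a ^ cycleLen g c) / (1 - Q ^ cycleLen g c)) =
    algebraMap ℂ K (symmetrizerScalar T) * Q ^ μ.nStat *
      ∏ c ∈ μ.cells, (1 - a * Q ^ content c) / (1 - Q ^ μ.hookLength c) := by
  -- Both sides as polynomials in `a`. They agree at `a = Q^N` for every `N` at least the number of
  -- rows, which are infinitely many points.
  let p : K[X] := ∑ g, C (algebraMap ℂ K ((youngSymmetrizer T).coeff g)) *
      ∏ c : CycleClass g, (1 - X ^ cycleLen g c) * C (1 - Q ^ cycleLen g c)⁻¹
  let r : K[X] := C (algebraMap ℂ K (symmetrizerScalar T) * Q ^ μ.nStat) *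
      ∏ c ∈ μ.cells, (1 - X * C (Q ^ content c)) * C (1 - Q ^ μ.hookLength c)⁻¹
  have hp : ∀ a, p.eval a = ∑ g, algebraMap ℂ K ((youngSymmetrizer T).coeff g) *
      ∏ c : CycleClass g, (1 - a ^ cycleLen g c) / (1 - Q ^ cycleLen g c) := fun a => by
    simp [p, eval_finsetSum, eval_prod, div_eq_mul_inv]
  have hr : ∀ a, r.eval a = algebraMap ℂ K (symmetrizerScalar T) * Q ^ μ.nStat *
      ∏ c ∈ μ.cells, (1 - a * Q ^ content c) / (1 - Q ^ μ.hookLength c) := fun a => by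
    simp only [r, eval_mul, eval_C, eval_prod, eval_sub, eval_one, eval_X, div_eq_mul_inv]
  have hinj : Function.Injective fun N : ℕ => Q ^ (N + μ.colLen 0) := by
    have key : ∀ i j : ℕ, i < j → Q ^ (i + μ.colLen 0) ≠ Q ^ (j + μ.colLen 0) := by
      intro i j hij he
      have : j + μ.colLen 0 = i + μ.colLen 0 + (j - i) := by omega
      rw [this, pow_add _ (i + μ.colLen 0)] at he
      exact hQ (j - i) (by omega)
        (mul_left_cancel₀ (pow_ne_zero (i + μ.colLen 0) hQ0) (he.symm.trans (mul_one _).symm))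
    intro i j hij
    rcases lt_trichotomy i j with h | h | h
    · exact absurd hij (key i j h)
    · exact h
    · exact absurd hij.symm (key j i h)
  have heq : p = r := by
    refine Polynomial.eq_of_infinite_eval_eq p r
      (Set.Infinite.mono ?_ (Set.infinite_range_of_injective hinj))
    rintro _ ⟨N, rfl⟩
    show p.eval _ = r.eval _
    rw [hp, hr]
    exact principal_specialization T (Nat.le_add_left _ _) hQ0 hQ
  rw [← hp, ← hr, heq]

theorem pow_X_ne_one {k : ℕ} (hk : k ≠ 0) : (RatFunc.X : RatFunc ℂ) ^ k ≠ 1 := by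
  intro h
  have h1 : algebraMap ℂ[X] (RatFunc ℂ) (X ^ k) = algebraMap ℂ[X] (RatFunc ℂ) 1 := by
    rw [map_pow, RatFunc.algebraMap_X, h, map_one]
  have h2 := congrArg natDegree (RatFunc.algebraMap_injective ℂ h1)
  rw [natDegree_X_pow, natDegree_one] at h2
  exact hk h2

/-- The Specht character paired with `∏ (1 + q ^ k)⁻¹`. -/
theorem sum_character_specht_prod (T : μ.Numbering n) :
    ∑ g, algebraMap ℂ (RatFunc ℂ) ((specht T).character g) *
      ∏ c : CycleClass g, (1 + RatFunc.X ^ cycleLen g c)⁻¹ =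
    (n.factorial : RatFunc ℂ) * (RatFunc.X ^ (2 * μ.nStat) *
      ∏ c ∈ μ.cells, (1 - RatFunc.X ^ (2 * content c + 1)) /
        (1 - RatFunc.X ^ (2 * μ.hookLength c))) := by
  have hX0 : (RatFunc.X : RatFunc ℂ) ≠ 0 := RatFunc.X_ne_zero
  -- With `Q = q^2` and `a = q` the cycle factor `(1 - q^k)/(1 - q^(2k))` is `1/(1 + q^k)`, and `a
  -- Q^c = q^(2c + 1)`.
  have h := specialization T (Q := (RatFunc.X : RatFunc ℂ) ^ 2) (pow_ne_zero 2 hX0)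
    (fun k hk => by rw [← pow_mul]; exact pow_X_ne_one (by omega)) RatFunc.X
  have h1 : ∀ g : Equiv.Perm (Fin n), ∏ c : CycleClass g, (1 - RatFunc.X ^ cycleLen g c) /
      (1 - ((RatFunc.X : RatFunc ℂ) ^ 2) ^ cycleLen g c) =
      ∏ c : CycleClass g, (1 + RatFunc.X ^ cycleLen g c)⁻¹ := fun g => by
    refine Finset.prod_congr rfl fun c _ => ?_
    have h2 : (1 : RatFunc ℂ) - RatFunc.X ^ cycleLen g c ≠ 0 :=
      sub_ne_zero.2 (pow_X_ne_one (cycleLen_pos g c).ne').symm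
    have h3 : (1 : RatFunc ℂ) - (RatFunc.X ^ 2) ^ cycleLen g c =
        (1 - RatFunc.X ^ cycleLen g c) * (1 + RatFunc.X ^ cycleLen g c) := by
      rw [← pow_mul, mul_comm 2, pow_mul]
      ring
    rw [h3, div_mul_eq_div_div, div_self h2, one_div]
  have h4 : ∀ c : ℕ × ℕ, RatFunc.X * ((RatFunc.X : RatFunc ℂ) ^ 2) ^ content c =
      RatFunc.X ^ (2 * content c + 1) := fun c => by
    rw [zpow_add_one₀ hX0, mul_comm, zpow_mul]
    rfl
  simp only [h1, h4] at h
  simp only [← pow_mul] at h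
  have h5 := sum_character_specht T (fun g : Equiv.Perm (Fin n) =>
    ∏ c : CycleClass g, (1 + (RatFunc.X : RatFunc ℂ) ^ cycleLen g c)⁻¹)
    (fun g h => prod_cycleLen_conj g h fun k => (1 + (RatFunc.X : RatFunc ℂ) ^ k)⁻¹)
    (fun g => prod_cycleLen_inv g fun k => (1 + (RatFunc.X : RatFunc ℂ) ^ k)⁻¹)
  rw [h, Fintype.card_perm, Fintype.card_fin] at h5
  have h6 : algebraMap ℂ (RatFunc ℂ) (symmetrizerScalar T) ≠ 0 := by
    rw [_root_.map_ne_zero]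
    exact symmetrizerScalar_ne_zero T
  refine mul_left_cancel₀ h6 (h5.trans ?_)
  ring

end YoungDiagram

end

/-! ### The elliptic fake degree -/

theorem propositionp (n : ℕ) (μ : YoungDiagram) (T : μ.Numbering n) :
    ellipticFakeDegree (reflB n)
        (ellipticClass (reflB n) (virtualCharacters.of (YoungDiagram.bipartitionEmpty T))) =
      (RatFunc.X - 1) ^ n * RatFunc.X ^ (2 * μ.nStat) *
        ∏ c ∈ μ.cells,
          (1 - RatFunc.X ^ (2 * YoungDiagram.content c + 1)) /
            (1 - RatFunc.X ^ (2 * μ.hookLength c)) := by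
  have hcard : (Fintype.card (WeylB n) : RatFunc ℂ) = 2 ^ n * (n.factorial : RatFunc ℂ) := by
    rw [Fintype.card_congr SemidirectProduct.equivProd, Fintype.card_prod, Fintype.card_fun,
      Fintype.card_perm, Fintype.card_fin, Fintype.card_units_int]
    push_cast
    rfl
  have hsum : ∑ w : WeylB n, RatFunc.C ((YoungDiagram.bipartitionEmpty T).character w *
      ((LinearMap.det (1 - reflB n w) : ℝ) : ℂ)) /
      algebraMap ℂ[X] (RatFunc ℂ) ((detOneSubQ (reflB n) w).map Complex.ofRealHom) =
      2 ^ n * ∑ g, algebraMap ℂ (RatFunc ℂ) ((YoungDiagram.specht T).character g) *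
        ∏ c : CycleClass g, (1 + RatFunc.X ^ cycleLen g c)⁻¹ := by
    -- The signs are summed first for fixed `g`, as the character depends only on `g`. The resulting
    -- `2^n`, with the later `n!`, cancels the order of the group.
    rw [← Equiv.sum_comp SemidirectProduct.equivProd.symm, Fintype.sum_prod_type_right,
      Finset.mul_sum]
    refine Finset.sum_congr rfl fun g _ => ?_
    rw [mul_left_comm, ← sum_signs_det_div, Finset.mul_sum]
    refine Finset.sum_congr rfl fun ε _ => ?_
    rw [map_mul, mul_div_assoc]
    rfl
  show fakeDegreeAux (reflB n) (virtualCharacters.of (YoungDiagram.bipartitionEmpty T)) = _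
  show (RatFunc.X - 1) ^ Module.finrank ℝ (Fin n → ℝ) / (Fintype.card (WeylB n) : RatFunc ℂ) *
    ∑ w : WeylB n, RatFunc.C ((YoungDiagram.bipartitionEmpty T).character w *
      ((LinearMap.det (1 - reflB n w) : ℝ) : ℂ)) /
      algebraMap ℂ[X] (RatFunc ℂ) ((detOneSubQ (reflB n) w).map Complex.ofRealHom) = _
  have h2 : (2 : RatFunc ℂ) ^ n ≠ 0 := pow_ne_zero _ two_ne_zero
  have hf : (n.factorial : RatFunc ℂ) ≠ 0 := by exact_mod_cast n.factorial_ne_zero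
  rw [hsum, YoungDiagram.sum_character_specht_prod, hcard, Module.finrank_fin_fun]
  field_simp
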